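/- Let $q_1,q_2\in\mathbb C$ be nonzero with $q_1\ne q_2$, and put $q=-q_2/q_1$, $[m]_q=1+q+\cdots+q^{m-1}$ and $[n]_q^!=[1]_q[2]_q\cdots[n]_q$. Let $\mathbf E=\mathbb C^n$ have standard basis $\mathbf e_1,\dots,\mathbf e_n$ and symmetric bilinear form $\langle \mathbf e_i,\mathbf e_j\rangle=\delta_{ij}q^{j-1}$, and let $\mathbf F\subset\mathbf E$ be the span of the vectors $q\mathbf e_i-\mathbf e_{i+1}$ $(1\le i\le n-1)$. Let $\mathrm O(\mathbf F)$ be the group of linear automorphisms of $\mathbf F$ preserving the restricted form. For $1\le i\le n-1$ let $T_i$ be the operator on $\mathbf E$ with $T_i\mathbf e_i=(q_1+q_2)\mathbf e_i+q_1\mathbf e_{i+1}$, $T_i\mathbf e_{i+1}=-q_2\mathbf e_i$ and $T_i\mathbf e_j=q_1\mathbf e_j$ for $j\ne i,i+1$, and let $S_i=\frac{1}{q_1-q_2}\bigl(2T_i-(q_1+q_2)\bigr)$. Let $TW_n$ be the twin group, generated by $t_1,\dots,t_{n-1}$ subject to $t_i^2=1$ and $t_it_j=t_jt_i$ for $|i-j|>1$.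 Then $t_i\mapsto S_i|_{\mathbf F}$ defines a homomorphism $TW_n\to\mathrm O(\mathbf F)$; let $G$ be its image and $\overline G$ the Zariski closure of $G$ in $\mathrm O(\mathbf F)$. Assume $[n]_q^!\ne0$. Fix square roots $\sqrt q$ and $[k]_q^{1/2}$ $(1\le k\le n)$ arbitrarily, put $\mathbf e_i'=(\sqrt q)^{-(i-1)}\mathbf e_i$ and $\mathbf f_i=\sqrt q\,\mathbf e_i'-\mathbf e_{i+1}'$, let $\mathbf v_1,\dots,\mathbf v_{n-1}$ be the orthogonal basis of $\mathbf F$ obtained from $\mathbf f_1,\dots,\mathbf f_{n-1}$ by the (unnormalized) Gram–Schmidt procedure, and let $\mathbf u_k=[k]_q^{-1/2}[k+1]_q^{-1/2}[k]_q\mathbf v_k$. Then $\mathbf u_1,\dots,\mathbf u_{n-1}$ is an orthonormal basis of $\mathbf F$. Identify elements of $\mathrm O(\mathbf F)$ with their matrices in this basis, so that $\mathrm O(\mathbf F)=\mathrm O_{n-1}(\mathbb C)$. Let $\Delta_i$ be the matrix of $S_i|_{\mathbf F}$, and $D_i$ the $(n-1)\times(n-1)$ diagonal matrix with $i$th diagonal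 entry $-1$ and all other diagonal entries $1$. Suppose that for each $i=1,\dots,n-2$ the matrix $D_i\Delta_{i+1}$ has infinite order. Then: (a) for all $k=2,\dots,n-1$, $\overline G$ contains $\mathrm{diag}(I_{k-2},\mathrm O_2(\mathbb C),I_{n-1-k})$, where $\mathrm O_2(\mathbb C)=\{A: A^{\mathsf T}A=I\}$; (b) $D_k\in\overline G$ for all $k=1,\dots,n-1$. Consequently $\overline G=\mathrm O(\mathbf F)$. -/

import Mathlib

noncomputable section

namespace TwinRep

/-! ### Quantum integers -/

/-- The quantum integer `[m]_q = 1 + q + ⋯ + q^(m-1)`. -/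
def qInt (q : ℂ) (m : ℕ) : ℂ := ∑ j ∈ Finset.range m, q ^ j

/-- The quantum factorial `[m]_q^! = [1]_q [2]_q ⋯ [m]_q`. -/
def qFactorial (q : ℂ) (m : ℕ) : ℂ := ∏ j ∈ Finset.range m, qInt q (j + 1)

/-! ### Orthogonal groups and Zariski closure -/

section General

variable {V : Type*} [AddCommGroup V] [Module ℂ V]

/-- The group of linear automorphisms of `V` that preserve the bilinear form `B`. -/
def orthGroup (B : LinearMap.BilinForm ℂ V) : Subgroup (V ≃ₗ[ℂ] V) where
  carrier := {g | ∀ v w, B (g v) (g w) = B v w}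
  mul_mem' := by
    intro a b ha hb v w
    exact (ha (b v) (b w)).trans (hb v w)
  one_mem' := fun _ _ => rfl
  inv_mem' := by
    intro a ha v w
    have h := ha (a.symm v) (a.symm w)
    rw [a.apply_symm_apply, a.apply_symm_apply] at h
    exact h.symm

/-- An element of the orthogonal group, seen as an endomorphism of `V`. -/
def orthToEnd {B : LinearMap.BilinForm ℂ V} (g : orthGroup B) : Module.End ℂ V :=
  (g : V ≃ₗ[ℂ] V).toLinearMap

/-- The polynomial functions on a complex vector space: the algebra of functions generated by
the linear functionals. -/
def polyFun (W : Type*) [AddCommGroup W] [Module ℂ W] : Subalgebra ℂ (W → ℂ) :=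
  Algebra.adjoin ℂ (Set.range fun φ : Module.Dual ℂ W => (φ : W → ℂ))

/-- The Zariski closure of `X` in the orthogonal group of `B`: the common zeros in that group of
the polynomial functions on `End V` that vanish on `X`. -/
def zariskiClosure (B : LinearMap.BilinForm ℂ V) (X : Set (orthGroup B)) : Set (orthGroup B) :=
  {g | ∀ p ∈ polyFun (Module.End ℂ V), (∀ x ∈ X, p (orthToEnd x) = 0) → p (orthToEnd g) = 0}

/-- Unnormalized Gram–Schmidt orthogonalization with respect to the bilinear form `B`:
`v i = f i - ∑_{j < i} (B (f i) (v j) / B (v j) (v j)) v j`. -/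
def bilinGramSchmidt {m : ℕ} (B : LinearMap.BilinForm ℂ V) (f : Fin m → V) (i : Fin m) : V :=
  f i - ∑ j : Finset.Iio i,
    (B (f i) (bilinGramSchmidt B f j) /
      B (bilinGramSchmidt B f j) (bilinGramSchmidt B f j)) • bilinGramSchmidt B f j
termination_by i
decreasing_by all_goals exact Fin.lt_def.1 (Finset.mem_Iio.1 j.2)

theorem mem_span_bilinGramSchmidt {m : ℕ} (B : LinearMap.BilinForm ℂ V) (f : Fin m → V)
    (i : Fin m) : f i ∈ Submodule.span ℂ (Set.range (bilinGramSchmidt B f)) := by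
  have h : f i = bilinGramSchmidt B f i + ∑ j : Finset.Iio i,
    (B (f i) (bilinGramSchmidt B f j) /
      B (bilinGramSchmidt B f j) (bilinGramSchmidt B f j)) • bilinGramSchmidt B f j := by
    rw [bilinGramSchmidt]
    exact (sub_add_cancel _ _).symm
  rw [h]
  refine Submodule.add_mem _ (Submodule.subset_span ⟨i, rfl⟩) (Submodule.sum_mem _ fun j _ => ?_)
  exact Submodule.smul_mem _ _ (Submodule.subset_span ⟨_, rfl⟩)

end General

/-! ### The space `E`, its form, and the operators. Indices start at `0`. -/

/-- For `i` in `{0, …, n - 2}`, the index `i` in `{0, …, n - 1}`. -/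
def lo {n : ℕ} (i : Fin (n - 1)) : Fin n := ⟨i, by omega⟩

/-- For `i` in `{0, …, n - 2}`, the index `i + 1` in `{0, …, n - 1}`. -/
def hi {n : ℕ} (i : Fin (n - 1)) : Fin n := ⟨i + 1, by omega⟩

/-- The standard basis vector `e_j` of `E = ℂⁿ`. -/
def e {n : ℕ} (j : Fin n) : Fin n → ℂ := Pi.single j 1

/-- The bilinear form on `E` with `⟨e_i, e_j⟩ = δ_{ij} q^j` for `i, j = 0, …, n - 1`. -/
def form (n : ℕ) (q : ℂ) : LinearMap.BilinForm ℂ (Fin n → ℂ) :=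
  Matrix.toBilin' (Matrix.diagonal fun j : Fin n => q ^ (j : ℕ))

/-- The operator `T_i` of the (generalized) Burau representation:
`e_i ↦ (q₁ + q₂) e_i + q₁ e_{i+1}`, `e_{i+1} ↦ -q₂ e_i`, and `e_j ↦ q₁ e_j` otherwise. -/
def T {n : ℕ} (q₁ q₂ : ℂ) (i : Fin (n - 1)) : Module.End ℂ (Fin n → ℂ) :=
  (Pi.basisFun ℂ (Fin n)).constr ℂ fun j =>
    if j = lo i then (q₁ + q₂) • e (lo i) + q₁ • e (hi i)
    else if j = hi i then -q₂ • e (lo i)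
    else q₁ • e j

/-- The operator `S_i = (2 T_i - (q₁ + q₂)) / (q₁ - q₂)`. -/
def S {n : ℕ} (q₁ q₂ : ℂ) (i : Fin (n - 1)) : Module.End ℂ (Fin n → ℂ) :=
  (1 / (q₁ - q₂)) • ((2 : ℂ) • T q₁ q₂ i - (q₁ + q₂) • 1)

/-- The vector `q e_i - e_{i+1}`. -/
def root {n : ℕ} (q : ℂ) (i : Fin (n - 1)) : Fin n → ℂ := q • e (lo i) - e (hi i)

/-- The subspace `F` of `E` spanned by the vectors `q e_i - e_{i+1}`. -/
def F (n : ℕ) (q : ℂ) : Submodule ℂ (Fin n → ℂ) :=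
  Submodule.span ℂ (Set.range fun i : Fin (n - 1) => root q i)

/-- The restriction of the bilinear form to `F`. -/
def formF (n : ℕ) (q : ℂ) : LinearMap.BilinForm ℂ (F n q) := (form n q).restrict (F n q)

/-- The parameter `q = -q₂ / q₁`. -/
def ratio (q₁ q₂ : ℂ) : ℂ := -q₂ / q₁

/-! ### The twin group and its reduced reflection representation -/

/-- The relators of the twin group: `t_i²`, and the commutator of `t_i` and `t_j` if `|i - j| > 1`. -/
def twinRels (n : ℕ) : Set (FreeGroup (Fin (n - 1))) :=
  {w | ∃ i, w = FreeGroup.of i ^ 2} ∪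
  {w | ∃ i j : Fin (n - 1), ((i : ℕ) + 1 < j ∨ (j : ℕ) + 1 < i) ∧
    w = FreeGroup.of i * FreeGroup.of j * (FreeGroup.of i)⁻¹ * (FreeGroup.of j)⁻¹}

/-- The twin group on `n` strands. -/
abbrev TwinGroup (n : ℕ) : Type := PresentedGroup (twinRels n)

/-- The generator `t_i` of the twin group. -/
def twinGen {n : ℕ} (i : Fin (n - 1)) : TwinGroup n := PresentedGroup.of i

theorem lo_ne_hi {n : ℕ} (i : Fin (n - 1)) : lo i ≠ hi i := by
  simp [lo, hi]

theorem T_apply {n : ℕ} {q₁ q₂ : ℂ} (h₁ : q₁ ≠ 0) (i : Fin (n - 1)) (v : Fin n → ℂ) :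
    T q₁ q₂ i v = q₁ • v - (q₁ * (v (lo i) - v (hi i))) • root (ratio q₁ q₂) i := by
  suffices h : T q₁ q₂ i = q₁ • LinearMap.id - (q₁ •
      (LinearMap.proj (R := ℂ) (φ := fun _ : Fin n => ℂ) (lo i) -
        LinearMap.proj (R := ℂ) (φ := fun _ : Fin n => ℂ) (hi i))).smulRight
        (root (ratio q₁ q₂) i) by
    rw [h]; simp
  refine (Pi.basisFun ℂ (Fin n)).ext fun j => ?_
  rw [T, Module.Basis.constr_basis]
  have hlh := lo_ne_hi i
  have hq : q₁ * ratio q₁ q₂ = -q₂ := by rw [ratio]; field_simp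
  by_cases hj : j = lo i
  · subst hj
    ext k
    simp [root, e, hlh.symm]
    linear_combination ((Pi.single (M := fun _ => ℂ) (lo i) 1 k : ℂ)) * hq
  · by_cases hj' : j = hi i
    · subst hj'
      ext k
      simp [root, e, hlh, hlh.symm]
      linear_combination (-(Pi.single (M := fun _ => ℂ) (lo i) 1 k : ℂ)) * hq
    · ext k
      simp [root, e, hj, hj', Ne.symm hj, Ne.symm hj']

theorem one_add_ratio_ne {q₁ q₂ : ℂ} (h₁ : q₁ ≠ 0) (h₁₂ : q₁ ≠ q₂) : 1 + ratio q₁ q₂ ≠ 0 := by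
  intro h
  apply h₁₂
  rw [ratio] at h
  field_simp at h
  linear_combination h

theorem S_apply {n : ℕ} {q₁ q₂ : ℂ} (h₁ : q₁ ≠ 0) (h₁₂ : q₁ ≠ q₂) (i : Fin (n - 1))
    (v : Fin n → ℂ) :
    S q₁ q₂ i v = v - (2 / (1 + ratio q₁ q₂) * (v (lo i) - v (hi i))) •
      root (ratio q₁ q₂) i := by
  have h := one_add_ratio_ne h₁ h₁₂
  have h' : q₁ - q₂ ≠ 0 := sub_ne_zero.2 h₁₂
  have hk : 2 / (1 + ratio q₁ q₂) = 2 * q₁ / (q₁ - q₂) := by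
    rw [div_eq_div_iff h h', ratio]; field_simp; ring
  rw [hk]
  simp only [S, LinearMap.smul_apply, LinearMap.sub_apply, Module.End.one_apply, T_apply h₁]
  ext k
  simp only [Pi.smul_apply, Pi.sub_apply, smul_eq_mul]
  field_simp
  ring

theorem S_mem_F {n : ℕ} {q₁ q₂ : ℂ} (h₁ : q₁ ≠ 0) (h₁₂ : q₁ ≠ q₂) (i : Fin (n - 1)) :
    ∀ v ∈ F n (ratio q₁ q₂), S q₁ q₂ i v ∈ F n (ratio q₁ q₂) := by
  intro v hv
  rw [S_apply h₁ h₁₂]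
  exact Submodule.sub_mem _ hv (Submodule.smul_mem _ _ (Submodule.subset_span ⟨i, rfl⟩))

theorem S_S {n : ℕ} {q₁ q₂ : ℂ} (h₁ : q₁ ≠ 0) (h₁₂ : q₁ ≠ q₂) (i : Fin (n - 1))
    (v : Fin n → ℂ) : S q₁ q₂ i (S q₁ q₂ i v) = v := by
  have h := one_add_ratio_ne h₁ h₁₂
  have hlh := lo_ne_hi i
  rw [S_apply h₁ h₁₂, S_apply h₁ h₁₂]
  ext k
  simp [root, e, hlh, hlh.symm]
  field_simp
  ring

theorem S_comm {n : ℕ} {q₁ q₂ : ℂ} (h₁ : q₁ ≠ 0) (h₁₂ : q₁ ≠ q₂) (i j : Fin (n - 1))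
    (hij : (i : ℕ) + 1 < j ∨ (j : ℕ) + 1 < i) (v : Fin n → ℂ) :
    S q₁ q₂ i (S q₁ q₂ j v) = S q₁ q₂ j (S q₁ q₂ i v) := by
  have a1 : lo i ≠ lo j := by simp [lo]; omega
  have a2 : lo i ≠ hi j := by simp [lo, hi]; omega
  have a3 : hi i ≠ lo j := by simp [lo, hi]; omega
  have a4 : hi i ≠ hi j := by simp [hi]; omega
  simp only [S_apply h₁ h₁₂]
  ext k
  simp [root, e, a1, a2, a3, a4, a1.symm, a2.symm, a3.symm, a4.symm]
  ring

theorem form_root {n : ℕ} (q : ℂ) (i : Fin (n - 1)) (v : Fin n → ℂ) :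
    form n q v (root q i) = q ^ ((i : ℕ) + 1) * (v (lo i) - v (hi i)) := by
  simp [form, root, e, Matrix.toBilin'_apply', Matrix.mulVec_sub, Matrix.mulVec_smul, lo, hi]
  ring

theorem form_comm {n : ℕ} (q : ℂ) (v w : Fin n → ℂ) : form n q v w = form n q w v := by
  simp only [form, Matrix.toBilin'_apply', dotProduct, Matrix.mulVec_diagonal]
  exact Finset.sum_congr rfl fun k _ => by ring

theorem form_S {n : ℕ} {q₁ q₂ : ℂ} (h₁ : q₁ ≠ 0) (h₁₂ : q₁ ≠ q₂) (i : Fin (n - 1))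
    (v w : Fin n → ℂ) :
    form n (ratio q₁ q₂) (S q₁ q₂ i v) (S q₁ q₂ i w) = form n (ratio q₁ q₂) v w := by
  have h := one_add_ratio_ne h₁ h₁₂
  have hlh := lo_ne_hi i
  rw [S_apply h₁ h₁₂, S_apply h₁ h₁₂]
  simp only [map_sub, map_smul, LinearMap.sub_apply, LinearMap.smul_apply, smul_eq_mul]
  rw [form_comm _ (root _ i) w]
  simp only [form_root]
  simp [root, e, hlh, hlh.symm]
  field_simp
  ring

/-- The operator `S_i` on `F`, as an element of the orthogonal group of `F`. -/
def SF {n : ℕ} {q₁ q₂ : ℂ} (h₁ : q₁ ≠ 0) (h₁₂ : q₁ ≠ q₂) (i : Fin (n - 1)) :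
    orthGroup (formF n (ratio q₁ q₂)) :=
  ⟨LinearEquiv.ofInvolutive ((S q₁ q₂ i).restrict (S_mem_F h₁ h₁₂ i))
      (fun v => Subtype.ext (S_S h₁ h₁₂ i v)),
    fun v w => form_S h₁ h₁₂ i v w⟩

/-- The reduced reflection representation of the twin group on `F`, given by `t_i ↦ S_i`. -/
def reducedRep (n : ℕ) {q₁ q₂ : ℂ} (h₁ : q₁ ≠ 0) (h₁₂ : q₁ ≠ q₂) :
    TwinGroup n →* orthGroup (formF n (ratio q₁ q₂)) :=
  PresentedGroup.toGroup (f := SF h₁ h₁₂) (by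
    rintro w (⟨i, rfl⟩ | ⟨i, j, hij, rfl⟩)
    · rw [map_pow, FreeGroup.lift_apply_of]
      refine Subtype.ext (LinearEquiv.ext fun v => Subtype.ext ?_)
      rw [pow_two]
      exact S_S h₁ h₁₂ i v
    · rw [map_mul, map_mul, map_mul, map_inv, map_inv, FreeGroup.lift_apply_of,
        FreeGroup.lift_apply_of, mul_inv_eq_one, mul_inv_eq_iff_eq_mul]
      refine Subtype.ext (LinearEquiv.ext fun v => Subtype.ext ?_)
      exact S_comm h₁ h₁₂ i j hij v)

/-! ### The orthonormal basis of `F` -/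

theorem linearIndependent_root {n : ℕ} {q : ℂ} (hq : q ≠ 0) :
    LinearIndependent ℂ fun i : Fin (n - 1) => root q i := by
  rw [Fintype.linearIndependent_iff]
  intro c hc
  have key : ∀ (m : ℕ) (hm : m < n - 1), c ⟨m, hm⟩ = 0 := by
    intro m
    induction m with
    | zero =>
      intro hm
      have h := congrFun hc (lo ⟨0, hm⟩)
      rw [Finset.sum_apply, Finset.sum_eq_single ⟨0, hm⟩] at h
      · simpa [root, e, lo, hi, hq] using h
      · intro b _ hb
        have hb' : (b : ℕ) ≠ 0 := fun h => hb (Fin.ext h)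
        simp [root, e, lo, hi, hb'.symm]
      · simp
    | succ m ih =>
      intro hm
      have h := congrFun hc (lo ⟨m + 1, hm⟩)
      rw [Finset.sum_apply, Finset.sum_eq_single ⟨m + 1, hm⟩] at h
      · simpa [root, e, lo, hi, hq] using h
      · intro b _ hb
        have hb' : (b : ℕ) ≠ m + 1 := fun h => hb (Fin.ext h)
        by_cases hbm : (b : ℕ) = m
        · have : b = ⟨m, by omega⟩ := Fin.ext hbm
          rw [this, ih]; simp
        · have : m ≠ (b : ℕ) := fun h => hbm h.symm
          simp [root, e, lo, hi, hb'.symm, this]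
      · simp
  exact fun i => key i i.2

theorem finrank_F {n : ℕ} {q : ℂ} (hq : q ≠ 0) : Module.finrank ℂ (F n q) = n - 1 := by
  rw [F, finrank_span_eq_card (linearIndependent_root hq), Fintype.card_fin]

/-- The orthonormal vector `e'_j = q^{-j/2} e_j` for `j = 0, …, n - 1`, where `s` is a
square root of `q`. -/
def eN {n : ℕ} (s : ℂ) (j : Fin n) : Fin n → ℂ := (s ^ (j : ℕ))⁻¹ • e j

theorem ff_eq {n : ℕ} {q s : ℂ} (hq : q ≠ 0) (hs : s ^ 2 = q) (i : Fin (n - 1)) :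
    s • eN s (lo i) - eN s (hi i) = (s ^ ((i : ℕ) + 1))⁻¹ • root q i := by
  have hs0 : s ≠ 0 := by rintro rfl; apply hq; rw [← hs]; simp
  rw [root, smul_sub, smul_smul, eN, eN, smul_smul, ← hs]
  simp only [lo, hi]
  congr 2
  field_simp
  ring

/-- The vector `f_i = √q e'_i - e'_{i+1}` of `F`, where `s` is a square root of `q`. -/
def ff {n : ℕ} {q s : ℂ} (hq : q ≠ 0) (hs : s ^ 2 = q) (i : Fin (n - 1)) : F n q :=
  ⟨s • eN s (lo i) - eN s (hi i), by
    rw [ff_eq hq hs]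
    exact Submodule.smul_mem _ _ (Submodule.subset_span ⟨i, rfl⟩)⟩

/-- The orthogonal vectors of `F` obtained from the `f_i` by the Gram–Schmidt procedure. -/
def vv {n : ℕ} {q s : ℂ} (hq : q ≠ 0) (hs : s ^ 2 = q) (i : Fin (n - 1)) : F n q :=
  bilinGramSchmidt (formF n q) (ff hq hs) i

/-- The vectors `u_k = [k]_q^{-1/2} [k+1]_q^{-1/2} [k]_q v_k` for `k = 1, …, n - 1`, where `k` is
`i + 1` and `r k` is a square root of `[k]_q`. -/
def uu {n : ℕ} {q s : ℂ} (hq : q ≠ 0) (hs : s ^ 2 = q) (r : ℕ → ℂ) (i : Fin (n - 1)) : F n q :=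
  ((r (i + 1))⁻¹ * (r (i + 2))⁻¹) • qInt q (i + 1) • vv hq hs i

theorem qInt_ne {n : ℕ} {q : ℂ} (hn : qFactorial q n ≠ 0) {m : ℕ} (hm : m < n) :
    qInt q (m + 1) ≠ 0 :=
  Finset.prod_ne_zero_iff.1 hn m (Finset.mem_range.2 hm)

theorem span_uu {n : ℕ} {q s : ℂ} (hq : q ≠ 0) (hs : s ^ 2 = q) {r : ℕ → ℂ}
    (hr : ∀ k, r k ^ 2 = qInt q k) (hn : qFactorial q n ≠ 0) :
    ⊤ ≤ Submodule.span ℂ (Set.range (uu (n := n) hq hs r)) := by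
  have hs0 : s ≠ 0 := by rintro rfl; apply hq; rw [← hs]; simp
  have hr0 : ∀ m < n, r (m + 1) ≠ 0 := by
    intro m hm h
    apply qInt_ne hn hm
    rw [← hr, h]; simp
  have hv : ∀ i, vv (n := n) hq hs i ∈ Submodule.span ℂ (Set.range (uu (n := n) hq hs r)) := by
    intro i
    have hc : (r (i + 1))⁻¹ * (r (i + 2))⁻¹ * qInt q (i + 1) ≠ 0 :=
      mul_ne_zero (mul_ne_zero (inv_ne_zero (hr0 _ (by omega)))
        (inv_ne_zero (hr0 (i + 1) (by omega)))) (qInt_ne hn (by omega))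
    have : vv hq hs i = ((r (i + 1))⁻¹ * (r (i + 2))⁻¹ * qInt q (i + 1))⁻¹ • uu hq hs r i := by
      rw [uu, smul_smul (_ * _), smul_smul, inv_mul_cancel₀ hc, one_smul]
    rw [this]
    exact Submodule.smul_mem _ _ (Submodule.subset_span ⟨i, rfl⟩)
  have hf : ∀ i, ff (n := n) hq hs i ∈ Submodule.span ℂ (Set.range (uu (n := n) hq hs r)) := by
    intro i
    refine Submodule.span_le.2 ?_ (mem_span_bilinGramSchmidt (formF n q) (ff hq hs) i)
    rintro _ ⟨j, rfl⟩
    exact hv j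
  have hle : F n q ≤ (Submodule.span ℂ (Set.range (uu (n := n) hq hs r))).map (F n q).subtype := by
    conv_lhs => rw [F]
    refine Submodule.span_le.2 ?_
    rintro _ ⟨i, rfl⟩
    refine ⟨(s ^ ((i : ℕ) + 1)) • ff hq hs i, Submodule.smul_mem _ _ (hf i), ?_⟩
    simp only [map_smul, Submodule.subtype_apply, ff]
    rw [ff_eq hq hs, smul_smul, mul_inv_cancel₀ (pow_ne_zero _ hs0), one_smul]
  rintro ⟨x, hx⟩ -
  obtain ⟨y, hy, hyx⟩ := hle hx
  have : y = ⟨x, hx⟩ := Subtype.ext hyx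
  exact this ▸ hy

/-- The vectors `u_1, …, u_{n-1}` as a basis of `F`. -/
def uBasis {n : ℕ} {q s : ℂ} (hq : q ≠ 0) (hs : s ^ 2 = q) {r : ℕ → ℂ}
    (hr : ∀ k, r k ^ 2 = qInt q k) (hn : qFactorial q n ≠ 0) :
    Module.Basis (Fin (n - 1)) ℂ (F n q) :=
  basisOfTopLeSpanOfCardEqFinrank (uu hq hs r) (span_uu hq hs hr hn)
    (by rw [finrank_F hq, Fintype.card_fin])

theorem ratio_ne {q₁ q₂ : ℂ} (h₁ : q₁ ≠ 0) (h₂ : q₂ ≠ 0) : ratio q₁ q₂ ≠ 0 :=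
  div_ne_zero (neg_ne_zero.2 h₂) h₁

/-- The matrix of an element of the orthogonal group of `F` with respect to a basis of `F`. -/
def orthMatrix {n : ℕ} {q : ℂ} (u : Module.Basis (Fin (n - 1)) ℂ (F n q))
    (g : orthGroup (formF n q)) : Matrix (Fin (n - 1)) (Fin (n - 1)) ℂ :=
  LinearMap.toMatrix u u (orthToEnd g)

/-- The diagonal matrix `D_i`, with `-1` at position `i` and `1` elsewhere. -/
def D {m : ℕ} (i : Fin m) : Matrix (Fin m) (Fin m) ℂ :=
  Matrix.diagonal fun j => if j = i then -1 else 1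

/-- The block diagonal matrix `diag(I_i, A, I_{m - i - 2})`. -/
def block {m : ℕ} (i : ℕ) (A : Matrix (Fin 2) (Fin 2) ℂ) : Matrix (Fin m) (Fin m) ℂ :=
  Matrix.of fun a b =>
    if (a : ℕ) = i ∧ (b : ℕ) = i then A 0 0
    else if (a : ℕ) = i ∧ (b : ℕ) = i + 1 then A 0 1
    else if (a : ℕ) = i + 1 ∧ (b : ℕ) = i then A 1 0
    else if (a : ℕ) = i + 1 ∧ (b : ℕ) = i + 1 then A 1 1
    else if a = b then 1 else 0

end TwinRep

end

open TwinRep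

/-! Indices start at 0. In the basis `u` each generator acts as the orthogonal reflection along
`f_i`, whose square norm `1 + q` is nonzero (`isometryMatrix_twinGen`). The Gram matrix of the `f_i`
is tridiagonal, so Gram–Schmidt is a two-term recursion with the closed-form solution `gsVec`, and
`f_i` has coordinates only at positions `i - 1` and `i` (`ffCoord_eq_zero`). Hence `S_0` is `D_0`,
while `S_{i+1}` is a reflection inside the plane of `u_i` and `u_{i+1}`.

Suppose that `D_i` lies in the closure. Then `D_i S_{i+1}` is a rotation of that plane, with
eigenvalues `ζ` and `ζ⁻¹` on it, and of infinite order. A polynomial function restricted to the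
rotations is a Laurent polynomial in the eigenvalue; if it vanishes on all powers of `ζ`, it is
zero. The closure therefore contains every rotation of the plane
(`IsOrthonormalBasis.block_rot_mem_closureMatrices`), and with `D_i` the full `O_2`, in particular
`D_{i+1}`. Induction from `D_0` gives (a) and (b).

Finally, conjugation by coordinate swaps spreads the reflections from adjacent planes to all
coordinate planes (`reflectsPlane_of_block_mem`). These move any unit vector to a basis vector, so
they generate the complex orthogonal group, one column at a time (`mem_of_transpose_mul_self`). -/

namespace TwinRep

open Matrix

/-! ### Reflections -/

section Reflections

variable {ι κ : Type*} [Fintype ι] [DecidableEq ι] [Fintype κ] [DecidableEq κ]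

/-- The matrix of the orthogonal reflection along `x` (the identity if `x` is isotropic). -/
noncomputable def reflMatrix (x : ι → ℂ) : Matrix ι ι ℂ :=
  1 - (2 / (x ⬝ᵥ x)) • vecMulVec x x

theorem reflMatrix_mulVec (x v : ι → ℂ) :
    reflMatrix x *ᵥ v = v - (2 / (x ⬝ᵥ x) * (x ⬝ᵥ v)) • x := by
  rw [reflMatrix, sub_mulVec, one_mulVec, smul_mulVec, vecMulVec_mulVec]
  ext k
  simp
  ring

theorem reflMatrix_transpose (x : ι → ℂ) : (reflMatrix x)ᵀ = reflMatrix x := by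
  simp [reflMatrix, transpose_vecMulVec]

theorem reflMatrix_smul {c : ℂ} (hc : c ≠ 0) (x : ι → ℂ) :
    reflMatrix (c • x) = reflMatrix x := by
  simp only [reflMatrix, smul_dotProduct, dotProduct_smul, smul_vecMulVec, vecMulVec_smul,
    smul_smul, smul_eq_mul]
  congr 2
  field_simp

theorem reflMatrix_mul_self (x : ι → ℂ) : reflMatrix x * reflMatrix x = 1 := by
  apply Matrix.ext_of_mulVec_single
  intro i
  rw [← mulVec_mulVec, reflMatrix_mulVec, reflMatrix_mulVec, one_mulVec]
  by_cases h : x ⬝ᵥ x = 0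
  · simp [h]
  · ext k
    simp only [dotProduct_sub, dotProduct_smul, Pi.sub_apply, Pi.smul_apply, smul_eq_mul]
    field_simp
    ring

theorem transpose_mul_reflMatrix (x : ι → ℂ) : (reflMatrix x)ᵀ * reflMatrix x = 1 := by
  rw [reflMatrix_transpose, reflMatrix_mul_self]

/-- Reflections along the images of a vector under an isometric embedding. -/
theorem reflMatrix_isometry_mulVec (K : Matrix ι κ ℂ) (hK : Kᵀ * K = 1) (y : κ → ℂ) :
    reflMatrix (K *ᵥ y) = 1 + K * (reflMatrix y - 1) * Kᵀ := by
  have h : (K *ᵥ y) ⬝ᵥ (K *ᵥ y) = y ⬝ᵥ y := by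
    rw [dotProduct_mulVec, vecMul_mulVec, hK, vecMul_one]
  have h' : vecMulVec (K *ᵥ y) (K *ᵥ y) = K * vecMulVec y y * Kᵀ := by
    rw [mul_vecMulVec, vecMulVec_mul, vecMul_transpose]
  rw [reflMatrix, reflMatrix, h, h']
  simp [Matrix.mul_smul, Matrix.smul_mul, sub_eq_add_neg]

theorem reflMatrix_conj (A : Matrix ι ι ℂ) (hA : Aᵀ * A = 1) (y : ι → ℂ) :
    reflMatrix (A *ᵥ y) = A * reflMatrix y * Aᵀ := by
  rw [reflMatrix_isometry_mulVec A hA, mul_sub, sub_mul, mul_one, mul_eq_one_comm.1 hA]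
  abel

/-- Equal norms give `(v - w) ⬝ᵥ (v - w) = 2 (v - w) ⬝ᵥ v`, so the reflection subtracts `v - w`
exactly once. -/
theorem reflMatrix_sub_mulVec {v w : ι → ℂ} (h : v ⬝ᵥ v = w ⬝ᵥ w)
    (hne : (v - w) ⬝ᵥ (v - w) ≠ 0) : reflMatrix (v - w) *ᵥ v = w := by
  have hc : 2 / ((v - w) ⬝ᵥ (v - w)) * ((v - w) ⬝ᵥ v) = 1 := by
    rw [div_mul_eq_mul_div, div_eq_one_iff_eq hne]
    simp only [sub_dotProduct, dotProduct_sub, dotProduct_comm w v]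
    linear_combination h
  rw [reflMatrix_mulVec, hc, one_smul, sub_sub_cancel]

theorem reflMatrix_mulVec_single_of_eq_zero {x : ι → ℂ} {k : ι} (h : x k = 0) :
    reflMatrix x *ᵥ Pi.single k 1 = Pi.single k 1 := by
  rw [reflMatrix_mulVec]
  simp [h]

theorem reflMatrix_single_sub_single {i j : ι} (hij : i ≠ j) (v : ι → ℂ) :
    reflMatrix (Pi.single i 1 - Pi.single j 1) *ᵥ v = v ∘ Equiv.swap i j := by
  rw [reflMatrix_mulVec]
  ext k
  by_cases hi : k = i
  · subst hi
    simp [sub_dotProduct, hij, hij.symm]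
    norm_num
  · by_cases hj : k = j
    · subst hj
      simp [sub_dotProduct, hij, hij.symm]
      norm_num
    · simp [Equiv.swap_apply_of_ne_of_ne hi hj, hi, hj]

end Reflections

/-! ### Generation of the complex orthogonal group by reflections in coordinate planes -/

section Generation

variable {ι : Type*} [Fintype ι] [DecidableEq ι]

/-- All reflections along nonisotropic vectors of the coordinate plane of `i` and `j` belong
to `M`. -/
def ReflectsPlane (M : Set (Matrix ι ι ℂ)) (i j : ι) : Prop :=
  ∀ x : ι → ℂ, (∀ k, k ≠ i → k ≠ j → x k = 0) → x ⬝ᵥ x ≠ 0 → reflMatrix x ∈ M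

theorem ReflectsPlane.symm {M : Set (Matrix ι ι ℂ)} {i j : ι} (h : ReflectsPlane M i j) :
    ReflectsPlane M j i := fun x hx => h x fun k hi hj => hx k hj hi

/-- The reflection along `e_j - e_k` belongs to `M` and swaps coordinates `j` and `k`; conjugation
by it carries the plane of `i, j` to the plane of `i, k`. -/
theorem ReflectsPlane.trans {M : Submonoid (Matrix ι ι ℂ)} {i j k : ι} (hij' : i ≠ j) (hjk : j ≠ k)
    (hij : ReflectsPlane (M : Set (Matrix ι ι ℂ)) i j)
    (h : ReflectsPlane (M : Set (Matrix ι ι ℂ)) j k) :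
    ReflectsPlane (M : Set (Matrix ι ι ℂ)) i k := by
  intro x hx hx0
  set P : Matrix ι ι ℂ := reflMatrix (Pi.single j 1 - Pi.single k 1) with hP
  have hPM : P ∈ M := by
    refine h _ (fun l h1 h2 => by simp [h1, h2]) ?_
    simp [hjk, hjk.symm]
  have hPx : P *ᵥ (P *ᵥ x) = x := by
    rw [mulVec_mulVec, reflMatrix_mul_self, one_mulVec]
  rw [← hPx, reflMatrix_conj P (transpose_mul_reflMatrix _), hP, reflMatrix_transpose]
  refine M.mul_mem (M.mul_mem hPM (hij _ ?_ ?_)) hPM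
  · intro l h1 h2
    rw [reflMatrix_single_sub_single hjk, Function.comp_apply]
    by_cases hlk : l = k
    · subst hlk
      rw [Equiv.swap_apply_right]
      exact hx j hij'.symm hjk
    · rw [Equiv.swap_apply_of_ne_of_ne h2 hlk]
      exact hx l h1 hlk
  · rwa [dotProduct_mulVec, vecMul_mulVec, transpose_mul_reflMatrix, vecMul_one]

/-- If two nonzero coordinates of `w` span a nonisotropic vector, a reflection in their plane
annihilates one of them. -/
theorem exists_reflMatrix_mulVec_apply_eq_zero (w : ι → ℂ) {j k : ι} (hjk : j ≠ k) (hj : w j ≠ 0)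
    (h : w j ^ 2 + w k ^ 2 ≠ 0) :
    ∃ x : ι → ℂ, (∀ l, l ≠ j → l ≠ k → x l = 0) ∧ x ⬝ᵥ x ≠ 0 ∧ (reflMatrix x *ᵥ w) j = 0 ∧
      ∀ l, l ≠ j → l ≠ k → (reflMatrix x *ᵥ w) l = w l := by
  -- The reflection is to send `(w j, w k)` to `(0, t)`, a vector of the same norm, so its axis is
  -- the difference `(w j, w k - t)`. This axis is nonisotropic because `t ≠ 0` and `t ≠ w k`, the
  -- latter from `w j ≠ 0`.
  obtain ⟨t, ht⟩ := IsAlgClosed.exists_pow_nat_eq (w j ^ 2 + w k ^ 2) (n := 2) (by norm_num)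
  have ht0 : t ≠ 0 := by
    rintro rfl
    exact h (by rw [← ht]; simp)
  have htk : t - w k ≠ 0 := by
    intro hk
    apply pow_ne_zero 2 hj
    linear_combination (t + w k) * hk - ht
  set x : ι → ℂ := Pi.single j (w j) + Pi.single k (w k - t) with hx
  have hxx : x ⬝ᵥ x = 2 * t * (t - w k) := by
    simp only [hx, add_dotProduct, single_dotProduct, Pi.add_apply, Pi.single_eq_same,
      Pi.single_eq_of_ne hjk, Pi.single_eq_of_ne hjk.symm]
    linear_combination -ht
  have hxw : x ⬝ᵥ w = t * (t - w k) := by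
    simp only [hx, add_dotProduct, single_dotProduct]
    linear_combination -ht
  have hc : 2 / (x ⬝ᵥ x) * (x ⬝ᵥ w) = 1 := by
    rw [hxx, hxw]
    field_simp
  have hxl : ∀ l, l ≠ j → l ≠ k → x l = 0 := fun l h1 h2 => by simp [hx, h1, h2]
  refine ⟨x, hxl, ?_, ?_, fun l h1 h2 => ?_⟩
  · rw [hxx]
    exact mul_ne_zero (mul_ne_zero two_ne_zero ht0) htk
  · rw [reflMatrix_mulVec, hc]
    simp [hx, hjk]
  · rw [reflMatrix_mulVec, hc]
    simp [hxl l h1 h2]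

/-- Induction on the number of nonzero coordinates of `w`: a plane reflection removes one of them as
long as some pair spans a nonisotropic vector. Only reflections supported in `T` are used, so the
other basis vectors stay fixed. -/
theorem exists_mem_mulVec_eq_single {M : Submonoid (Matrix ι ι ℂ)}
    (hM : ∀ i j, ReflectsPlane (M : Set (Matrix ι ι ℂ)) i j) {T : Finset ι} {i : ι} (hi : i ∈ T)
    (w : ι → ℂ) (hw : w ⬝ᵥ w = 1) (hT : ∀ k ∉ T, w k = 0) :
    ∃ h ∈ M, hᵀ * h = 1 ∧ h *ᵥ w = Pi.single i 1 ∧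
      ∀ k ∉ T, h *ᵥ Pi.single k 1 = Pi.single k 1 := by
  induction hN : (Finset.univ.filter fun k => w k ≠ 0).card using Nat.strong_induction_on
    generalizing w with
  | _ N ih =>
  by_cases hex : ∃ j k, j ≠ k ∧ w j ≠ 0 ∧ w k ≠ 0 ∧ w j ^ 2 + w k ^ 2 ≠ 0
  · obtain ⟨j, k, hjk, hj, hk, hsum⟩ := hex
    obtain ⟨x, hx, hx0, hxj, hxl⟩ := exists_reflMatrix_mulVec_apply_eq_zero w hjk hj hsum
    have hjT : j ∈ T := by_contra fun h => hj (hT j h)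
    have hkT : k ∈ T := by_contra fun h => hk (hT k h)
    have hlj : ∀ l ∉ T, l ≠ j := fun l hl h => hl (h ▸ hjT)
    have hlk : ∀ l ∉ T, l ≠ k := fun l hl h => hl (h ▸ hkT)
    obtain ⟨h, hhM, hh, hhw, hhT⟩ := ih _ (by
        rw [← hN]
        apply Finset.card_lt_card
        rw [Finset.ssubset_iff_of_subset]
        · exact ⟨j, by simp [hj], by simp [hxj]⟩
        · intro l
          simp only [Finset.mem_filter, Finset.mem_univ, true_and]
          intro hl
          by_cases h1 : l = j
          · exact h1 ▸ hj
          by_cases h2 : l = k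
          · exact h2 ▸ hk
          rwa [← hxl l h1 h2]) (reflMatrix x *ᵥ w)
      (by rw [dotProduct_mulVec, vecMul_mulVec, transpose_mul_reflMatrix, vecMul_one, hw])
      (fun l hl => by rw [hxl l (hlj l hl) (hlk l hl), hT l hl]) rfl
    refine ⟨h * reflMatrix x, M.mul_mem hhM (hM j k x hx hx0), ?_, ?_, ?_⟩
    · rw [transpose_mul, Matrix.mul_assoc, ← Matrix.mul_assoc hᵀ, hh, one_mul,
        transpose_mul_reflMatrix]
    · rw [← mulVec_mulVec, hhw]
    · intro l hl
      rw [← mulVec_mulVec,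
        reflMatrix_mulVec_single_of_eq_zero (hx l (hlj l hl) (hlk l hl)), hhT l hl]
  -- Now any two nonzero coordinates satisfy `w j ^ 2 = -w k ^ 2`. Three of them would force `w j ^
  -- 2 = 0`, and exactly two would make `w` isotropic; so only one is left, and a last reflection
  -- along `w - e_i` suffices unless `w` is already `e_i`.
  · push Not at hex
    obtain ⟨j, hj⟩ : ∃ j, w j ≠ 0 := by
      by_contra! h
      rw [show w = 0 from funext h] at hw
      simp at hw
    have hwk : ∀ k, k ≠ j → w k = 0 := by
      intro k hkj
      by_contra hk
      have hjk := hex j k hkj.symm hj hk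
      have hl : ∀ l, l ≠ j → l ≠ k → w l = 0 := by
        intro l hlj hlk
        by_contra hl
        have h1 := hex j l hlj.symm hj hl
        have h2 := hex k l hlk.symm hk hl
        apply pow_ne_zero 2 hj
        linear_combination (hjk + h1 - h2) / 2
      rw [dotProduct, Fintype.sum_eq_add j k hkj.symm (fun l hl' => by
        rw [hl l hl'.1 hl'.2, zero_mul])] at hw
      exact one_ne_zero (hw.symm.trans (by linear_combination hjk))
    by_cases hwi : w i = 1
    · refine ⟨1, M.one_mem, by simp, ?_, fun k _ => one_mulVec _⟩
      have hij : i = j := by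
        by_contra hij
        rw [hwk i hij] at hwi
        exact zero_ne_one hwi
      rw [one_mulVec]
      ext k
      by_cases hk : k = i
      · subst hk; simp [hwi]
      · rw [hwk k (hij ▸ hk)]; simp [hk]
    · have hne : (w - Pi.single i 1) ⬝ᵥ (w - Pi.single i 1) ≠ 0 := by
        have : (w - Pi.single i 1) ⬝ᵥ (w - Pi.single i 1) = 2 * (1 - w i) := by
          simp only [sub_dotProduct, dotProduct_sub, hw, dotProduct_single, single_dotProduct,
            Pi.sub_apply, Pi.single_eq_same]
          ring
        rw [this]
        exact mul_ne_zero two_ne_zero (sub_ne_zero.2 (Ne.symm hwi))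
      refine ⟨reflMatrix (w - Pi.single i 1), hM i j _ ?_ hne, transpose_mul_reflMatrix _,
        reflMatrix_sub_mulVec (by simp [hw]) hne, fun k hk => ?_⟩
      · intro k h1 h2
        simp [h1, hwk k h2]
      · apply reflMatrix_mulVec_single_of_eq_zero
        have : k ≠ i := fun h => hk (h ▸ hi)
        simp [this, hT k hk]

/-- The complex orthogonal group is generated by the reflections in coordinate planes. -/
theorem mem_of_transpose_mul_self {M : Submonoid (Matrix ι ι ℂ)}
    (hM : ∀ i j, ReflectsPlane (M : Set (Matrix ι ι ℂ)) i j) (hMt : ∀ A ∈ M, Aᵀ ∈ M)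
    {A : Matrix ι ι ℂ} (hA : Aᵀ * A = 1) : A ∈ M := by
  -- The induction is on a set `T` of basis vectors that `A` is allowed to move.
  suffices H : ∀ T : Finset ι, ∀ A : Matrix ι ι ℂ, Aᵀ * A = 1 →
      (∀ k ∉ T, A *ᵥ Pi.single k 1 = Pi.single k 1) → A ∈ M from
    H Finset.univ A hA (by simp)
  intro T
  induction T using Finset.induction_on with
  | empty =>
    intro A _ h
    have : A = 1 := Matrix.ext_of_mulVec_single fun i => by rw [h i (by simp), one_mulVec]
    exact this ▸ M.one_mem
  | insert i T hiT ih =>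
    intro A hA h
    have hdot : ∀ v w : ι → ℂ, (A *ᵥ v) ⬝ᵥ (A *ᵥ w) = v ⬝ᵥ w := fun v w => by
      rw [dotProduct_mulVec, vecMul_mulVec, hA, vecMul_one]
    -- The column `A e_i` is supported in `insert i T`: for `k` outside, `A` fixes `e_k` and
    -- preserves the dot product, so `A e_i` is orthogonal to `e_k`. Then `g` undoes `A` on `e_i`,
    -- and `g * A` moves only `T`.
    obtain ⟨g, hgM, hg, hgi, hgT⟩ := exists_mem_mulVec_eq_single hM (Finset.mem_insert_self i T)
      (A *ᵥ Pi.single i 1) (by rw [hdot]; simp) (fun k hk => by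
        have h1 := hdot (Pi.single k 1) (Pi.single i 1)
        rw [h k hk, single_dotProduct, one_mul, single_dotProduct, one_mul,
          Pi.single_eq_of_ne] at h1
        · exact h1
        · rintro rfl
          exact hk (Finset.mem_insert_self _ _))
    have hgA : g * A ∈ M := by
      refine ih _ ?_ fun k hk => ?_
      · rw [transpose_mul, Matrix.mul_assoc, ← Matrix.mul_assoc gᵀ, hg, one_mul, hA]
      · rw [← mulVec_mulVec]
        by_cases hki : k = i
        · rw [hki, hgi]
        · have hk' : k ∉ insert i T := by simp [hki, hk]
          rw [h k hk', hgT k hk']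
    have : A = gᵀ * (g * A) := by rw [← Matrix.mul_assoc, hg, one_mul]
    rw [this]
    exact M.mul_mem (hMt g hgM) hgA

end Generation

/-! ### Block diagonal matrices -/

section Block

variable {m : ℕ}

/-- The inclusion of the coordinate plane of `i` and `i + 1`. -/
def planeIncl (m i : ℕ) : Matrix (Fin m) (Fin 2) ℂ :=
  Matrix.of fun a b => if (a : ℕ) = i + b then 1 else 0

theorem planeIncl_transpose_mul {i : ℕ} (hi : i + 1 < m) :
    (planeIncl m i)ᵀ * planeIncl m i = 1 := by
  ext a b
  rw [mul_apply, Finset.sum_eq_single ⟨i + a, by omega⟩]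
  · by_cases h : a = b
    · subst h; simp [planeIncl]
    · have : (a : ℕ) ≠ b := fun h' => h (Fin.ext h')
      simp [planeIncl, h, this]
  · intro c _ hc
    have : (c : ℕ) ≠ i + a := fun h => hc (Fin.ext h)
    simp [planeIncl, this]
  · simp

/-- In this form, block calculus reduces to the relation `Kᵀ * K = 1` for the inclusion `K` of the
plane, and it matches `reflMatrix_isometry_mulVec`. -/
theorem block_eq (i : ℕ) (A : Matrix (Fin 2) (Fin 2) ℂ) :
    (block i A : Matrix (Fin m) (Fin m) ℂ) = 1 + planeIncl m i * (A - 1) * (planeIncl m i)ᵀ := by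
  ext a b
  simp only [block, planeIncl, of_apply, Matrix.add_apply, mul_apply, Fin.sum_univ_two, transpose_apply,
    Matrix.sub_apply, one_apply, Fin.ext_iff]
  simp only [Fin.coe_ofNat_eq_mod]
  split_ifs <;> first | omega | simp_all

theorem block_mul_block {i : ℕ} (hi : i + 1 < m) (A B : Matrix (Fin 2) (Fin 2) ℂ) :
    (block i A * block i B : Matrix (Fin m) (Fin m) ℂ) = block i (A * B) := by
  have h : planeIncl m i * (A - 1) * (planeIncl m i)ᵀ *
      (planeIncl m i * (B - 1) * (planeIncl m i)ᵀ) =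
      planeIncl m i * ((A - 1) * (B - 1)) * (planeIncl m i)ᵀ := by
    calc _ = planeIncl m i * (A - 1) * ((planeIncl m i)ᵀ * planeIncl m i) * (B - 1) *
          (planeIncl m i)ᵀ := by simp only [Matrix.mul_assoc]
      _ = _ := by rw [planeIncl_transpose_mul hi]; simp only [Matrix.mul_assoc, Matrix.one_mul]
  rw [block_eq, block_eq, block_eq, mul_add, add_mul, add_mul, h, one_mul, mul_one, one_mul,
    add_assoc, ← Matrix.add_mul, ← Matrix.mul_add, ← Matrix.add_mul, ← Matrix.mul_add]
  congr 4
  noncomm_ring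

theorem block_one (i : ℕ) : (block i 1 : Matrix (Fin m) (Fin m) ℂ) = 1 := by
  simp [block_eq]

theorem block_pow {i : ℕ} (hi : i + 1 < m) (A : Matrix (Fin 2) (Fin 2) ℂ) (k : ℕ) :
    (block i A : Matrix (Fin m) (Fin m) ℂ) ^ k = block i (A ^ k) := by
  induction k with
  | zero => rw [pow_zero, pow_zero, block_one]
  | succ k ih => rw [pow_succ, ih, block_mul_block hi, pow_succ]

theorem reflMatrix_planeIncl_mulVec {i : ℕ} (hi : i + 1 < m) (y : Fin 2 → ℂ) :
    reflMatrix (planeIncl m i *ᵥ y) = block i (reflMatrix y) := by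
  rw [reflMatrix_isometry_mulVec _ (planeIncl_transpose_mul hi), block_eq]

theorem eq_planeIncl_mulVec {i : ℕ} (hi : i + 1 < m) {x : Fin m → ℂ}
    (hx : ∀ k : Fin m, (k : ℕ) ≠ i → (k : ℕ) ≠ i + 1 → x k = 0) :
    x = planeIncl m i *ᵥ ![x ⟨i, by omega⟩, x ⟨i + 1, hi⟩] := by
  ext k
  simp only [mulVec, dotProduct, Fin.sum_univ_two, planeIncl, of_apply]
  by_cases h1 : (k : ℕ) = i
  · subst h1; simp
  · by_cases h2 : (k : ℕ) = i + 1
    · have : k = ⟨i + 1, hi⟩ := Fin.ext h2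
      subst this
      simp
    · simp [h1, h2, hx k h1 h2]

theorem reflMatrix_single (i : Fin m) : reflMatrix (Pi.single i 1) = D i := by
  ext a b
  simp only [reflMatrix, D, single_dotProduct, Pi.single_eq_same, Matrix.sub_apply, Matrix.smul_apply,
    vecMulVec_apply, one_apply, diagonal_apply, smul_eq_mul]
  by_cases ha : a = i
  · subst ha
    by_cases hb : a = b
    · subst hb; simp; norm_num
    · simp [hb, Ne.symm hb]
  · simp [ha]

theorem block_reflMatrix_left {i : ℕ} (hi : i + 1 < m) :
    block i (reflMatrix ![1, 0]) = D (⟨i, by omega⟩ : Fin m) := by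
  rw [← reflMatrix_single, eq_planeIncl_mulVec hi (x := Pi.single ⟨i, _⟩ 1),
    reflMatrix_planeIncl_mulVec hi]
  · simp
  · intro k h _
    exact Pi.single_eq_of_ne (fun h' => h (Fin.ext_iff.1 h')) _

theorem block_reflMatrix_right {i : ℕ} (hi : i + 1 < m) :
    block i (reflMatrix ![0, 1]) = D (⟨i + 1, hi⟩ : Fin m) := by
  rw [← reflMatrix_single, eq_planeIncl_mulVec hi (x := Pi.single ⟨i + 1, _⟩ 1),
    reflMatrix_planeIncl_mulVec hi]
  · simp
  · intro k _ h
    exact Pi.single_eq_of_ne (fun h' => h (Fin.ext_iff.1 h')) _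

end Block

/-! ### Plane rotations -/

section Rotation

/-- The complex plane rotation with eigenvalues `z` and `z⁻¹`. -/
noncomputable def rot (z : ℂ) : Matrix (Fin 2) (Fin 2) ℂ :=
  !![(z + z⁻¹) / 2, (z - z⁻¹) / 2 * Complex.I; -((z - z⁻¹) / 2 * Complex.I), (z + z⁻¹) / 2]

theorem rot_one : rot 1 = 1 := by
  ext a b
  fin_cases a <;> fin_cases b <;> simp [rot]

theorem rot_mul {z w : ℂ} : rot z * rot w = rot (z * w) := by
  ext a b
  fin_cases a <;> fin_cases b <;> simp [rot, mul_apply, Fin.sum_univ_two] <;>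
    ring_nf <;> simp <;> ring

theorem rot_pow (z : ℂ) (k : ℕ) : rot z ^ k = rot (z ^ k) := by
  induction k with
  | zero => simp [rot_one]
  | succ k ih => rw [pow_succ, ih, rot_mul, pow_succ]

/-- Orthogonality and determinant 1 force rows `(a, -b)` and `(b, a)` with `a² + b² = 1`. Over `ℂ`
this factors as `(a + bi)(a - bi) = 1`, so `z = a + bi` has inverse `a - bi`. -/
theorem exists_eq_rot {A : Matrix (Fin 2) (Fin 2) ℂ} (hA : Aᵀ * A = 1) (hdet : A.det = 1) :
    ∃ z ≠ 0, A = rot z := by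
  rw [det_fin_two] at hdet
  have h00 := congrFun₂ hA 0 0
  have h01 := congrFun₂ hA 0 1
  simp only [mul_apply, Fin.sum_univ_two, transpose_apply, one_apply_eq] at h00
  simp only [mul_apply, Fin.sum_univ_two, transpose_apply, one_apply,
    zero_ne_one, if_false] at h01
  have hd : A 1 1 = A 0 0 := by
    linear_combination -(A 1 1) * h00 + A 1 0 * h01 + A 0 0 * hdet
  have hb : A 0 1 = -A 1 0 := by
    linear_combination -(A 0 1) * h00 + A 0 0 * h01 - A 1 0 * hdet
  have hz : (A 0 0 + A 1 0 * Complex.I) * (A 0 0 - A 1 0 * Complex.I) = 1 := by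
    linear_combination h00 - A 1 0 ^ 2 * Complex.I_sq
  refine ⟨A 0 0 + A 1 0 * Complex.I, left_ne_zero_of_mul_eq_one hz, ?_⟩
  rw [rot, inv_eq_of_mul_eq_one_right hz]
  ext a b
  fin_cases a <;> fin_cases b <;> simp
  · rw [hb]
    linear_combination -A 1 0 * Complex.I_sq
  · linear_combination A 1 0 * Complex.I_sq
  · exact hd

theorem det_reflMatrix {y : Fin 2 → ℂ} (hy : y ⬝ᵥ y ≠ 0) : (reflMatrix y).det = -1 := by
  rw [det_fin_two]
  have h : y 0 ^ 2 + y 1 ^ 2 ≠ 0 := by simpa [dotProduct, Fin.sum_univ_two, sq] using hy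
  simp only [reflMatrix, dotProduct, Fin.sum_univ_two, Matrix.sub_apply, Matrix.smul_apply, vecMulVec_apply,
    one_apply, smul_eq_mul]
  simp only [if_true, zero_ne_one, one_ne_zero, if_false, ← sq]
  field_simp
  ring

theorem det_eq_one_or {A : Matrix (Fin 2) (Fin 2) ℂ} (hA : Aᵀ * A = 1) :
    A.det = 1 ∨ A.det = -1 := by
  have h := congrArg Matrix.det hA
  rw [det_mul, det_transpose, det_one] at h
  exact mul_self_eq_one_iff.1 h

end Rotation

/-! ### The Zariski closure of a subgroup -/

section Closure

variable {V : Type*} [AddCommGroup V] [Module ℂ V] {B : LinearMap.BilinForm ℂ V}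

theorem orthToEnd_mul (g h : orthGroup B) : orthToEnd (g * h) = orthToEnd g * orthToEnd h := rfl

theorem polyFun_comp_linearMap {W W' : Type*} [AddCommGroup W] [Module ℂ W] [AddCommGroup W']
    [Module ℂ W'] (L : W →ₗ[ℂ] W') {p : W' → ℂ} (hp : p ∈ polyFun W') : p ∘ L ∈ polyFun W := by
  induction hp using Algebra.adjoin_induction with
  | mem f hf =>
    obtain ⟨φ, rfl⟩ := hf
    exact Algebra.subset_adjoin ⟨φ ∘ₗ L, rfl⟩
  | algebraMap c => exact (polyFun W).algebraMap_mem c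
  | add f g _ _ hf hg => exact (polyFun W).add_mem hf hg
  | mul f g _ _ hf hg => exact (polyFun W).mul_mem hf hg

theorem subset_zariskiClosure (X : Set (orthGroup B)) : X ⊆ zariskiClosure B X :=
  fun g hg _ _ h => h g hg

/-- A map of the orthogonal group that extends to a linear map of endomorphisms is continuous
for the Zariski topology. -/
theorem map_mem_zariskiClosure {X : Set (orthGroup B)} (L : Module.End ℂ V →ₗ[ℂ] Module.End ℂ V)
    (ψ : orthGroup B → orthGroup B) (hψ : ∀ g, orthToEnd (ψ g) = L (orthToEnd g))
    (hX : ∀ x ∈ X, ψ x ∈ zariskiClosure B X) {g : orthGroup B} (hg : g ∈ zariskiClosure B X) :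
    ψ g ∈ zariskiClosure B X := by
  intro p hp h
  rw [hψ]
  refine hg (p ∘ L) (polyFun_comp_linearMap L hp) fun x hx => ?_
  rw [Function.comp_apply, ← hψ]
  exact hX x hx p hp h

/-- Two passes: left translation by an element of `G` preserves `G`, hence its closure; so right
translation by a point `h` of the closure sends `G`, and then the closure of `G`, into the closure.
-/
theorem mul_mem_zariskiClosure (G : Subgroup (orthGroup B)) {g h : orthGroup B}
    (hg : g ∈ zariskiClosure B (G : Set (orthGroup B)))
    (hh : h ∈ zariskiClosure B (G : Set (orthGroup B))) :
    g * h ∈ zariskiClosure B (G : Set (orthGroup B)) := by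
  refine map_mem_zariskiClosure (LinearMap.mulRight ℂ (orthToEnd h)) (· * h)
    (fun x => orthToEnd_mul x h) (fun x hx => ?_) hg
  exact map_mem_zariskiClosure (LinearMap.mulLeft ℂ (orthToEnd x)) (x * ·)
    (fun y => orthToEnd_mul x y) (fun y hy => subset_zariskiClosure _ (G.mul_mem hx hy)) hh

/-! ### Matrices of isometries and of the closure in an orthonormal basis -/

variable {m : ℕ} (u : Module.Basis (Fin m) ℂ V)

/-- The basis `u` is orthonormal with respect to the bilinear form `B`. -/
def IsOrthonormalBasis (B : LinearMap.BilinForm ℂ V) (u : Module.Basis (Fin m) ℂ V) : Prop :=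
  ∀ i j, B (u i) (u j) = if i = j then 1 else 0

/-- The matrix of an isometry in a given basis. -/
noncomputable def isometryMatrix : orthGroup B →* Matrix (Fin m) (Fin m) ℂ where
  toFun g := LinearMap.toMatrix u u (orthToEnd g)
  map_one' := LinearMap.toMatrix_one u
  map_mul' g h := LinearMap.toMatrix_mul u (orthToEnd g) (orthToEnd h)

theorem isometryMatrix_injective :
    Function.Injective (isometryMatrix u : orthGroup B →* Matrix (Fin m) (Fin m) ℂ) := by
  intro g h hgh
  exact Subtype.ext (LinearEquiv.toLinearMap_injective ((LinearMap.toMatrix u u).injective hgh))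

variable {u} (hu : IsOrthonormalBasis B u)
include hu

theorem IsOrthonormalBasis.toMatrix_eq_one : LinearMap.BilinForm.toMatrix u B = 1 := by
  ext i j
  rw [LinearMap.BilinForm.toMatrix_apply, hu, one_apply]

theorem IsOrthonormalBasis.repr_apply (v : V) (i : Fin m) : u.repr v i = B (u i) v := by
  conv_rhs => rw [← u.sum_repr v]
  rw [map_sum, Finset.sum_eq_single i (fun j _ hj => by rw [map_smul, hu, if_neg hj.symm, smul_zero])
    (by simp), map_smul, hu, if_pos rfl, smul_eq_mul, mul_one]

theorem IsOrthonormalBasis.forall_isometry_iff (f : Module.End ℂ V) :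
    (∀ v w, B (f v) (f w) = B v w) ↔
      (LinearMap.toMatrix u u f)ᵀ * LinearMap.toMatrix u u f = 1 := by
  have h : (LinearMap.toMatrix u u f)ᵀ * LinearMap.toMatrix u u f =
      LinearMap.BilinForm.toMatrix u (B.comp f f) := by
    rw [LinearMap.BilinForm.toMatrix_comp u u, hu.toMatrix_eq_one, Matrix.mul_one]
  rw [h, ← hu.toMatrix_eq_one, (LinearMap.BilinForm.toMatrix u).injective.eq_iff]
  exact ⟨fun h => LinearMap.ext₂ h, fun h v w => LinearMap.congr_fun₂ h v w⟩

theorem IsOrthonormalBasis.transpose_mul_isometryMatrix (g : orthGroup B) :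
    (isometryMatrix u g)ᵀ * isometryMatrix u g = 1 :=
  (hu.forall_isometry_iff _).1 g.2

theorem IsOrthonormalBasis.isometryMatrix_inv (g : orthGroup B) :
    isometryMatrix u g⁻¹ = (isometryMatrix u g)ᵀ := by
  have h : isometryMatrix u g * isometryMatrix u g⁻¹ = 1 := by
    rw [← map_mul, mul_inv_cancel, map_one]
  calc _ = (isometryMatrix u g)ᵀ * isometryMatrix u g * isometryMatrix u g⁻¹ := by
        rw [hu.transpose_mul_isometryMatrix, Matrix.one_mul]
    _ = _ := by rw [Matrix.mul_assoc, h, Matrix.mul_one]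

theorem IsOrthonormalBasis.exists_isometryMatrix_eq {A : Matrix (Fin m) (Fin m) ℂ}
    (hA : Aᵀ * A = 1) : ∃ g : orthGroup B, isometryMatrix u g = A := by
  refine ⟨⟨LinearEquiv.ofLinearMap (Matrix.toLin u u A) (Matrix.toLin u u Aᵀ) ?_ ?_,
    (hu.forall_isometry_iff (Matrix.toLin u u A)).2 ?_⟩, ?_⟩
  · rw [← Matrix.toLin_mul, mul_eq_one_comm.1 hA, Matrix.toLin_one]
  · rw [← Matrix.toLin_mul, hA, Matrix.toLin_one]
  · rwa [LinearMap.toMatrix_toLin]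
  · exact LinearMap.toMatrix_toLin u u A

/-- In an orthonormal basis inversion is transposition, which extends linearly to all endomorphisms,
so `map_mem_zariskiClosure` applies. -/
theorem IsOrthonormalBasis.inv_mem_zariskiClosure (G : Subgroup (orthGroup B)) {g : orthGroup B}
    (hg : g ∈ zariskiClosure B (G : Set (orthGroup B))) :
    g⁻¹ ∈ zariskiClosure B (G : Set (orthGroup B)) := by
  refine map_mem_zariskiClosure ((Matrix.toLin u u).toLinearMap ∘ₗ
      (Matrix.transposeLinearEquiv (Fin m) (Fin m) ℂ ℂ).toLinearMap ∘ₗ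
      (LinearMap.toMatrix u u).toLinearMap) (·⁻¹) (fun x => ?_)
    (fun x hx => subset_zariskiClosure _ (G.inv_mem hx)) hg
  apply (LinearMap.toMatrix u u).injective
  refine (hu.isometryMatrix_inv x).trans ?_
  exact (LinearMap.toMatrix_toLin u u _).symm

omit hu in
/-- The matrices of the elements of the Zariski closure of a subgroup. -/
noncomputable def closureMatrices (u : Module.Basis (Fin m) ℂ V) (G : Subgroup (orthGroup B)) :
    Submonoid (Matrix (Fin m) (Fin m) ℂ) :=
  Submonoid.map (isometryMatrix u)
    { carrier := zariskiClosure B (G : Set (orthGroup B))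
      mul_mem' := mul_mem_zariskiClosure G
      one_mem' := subset_zariskiClosure _ G.one_mem }

theorem IsOrthonormalBasis.transpose_mem_closureMatrices {G : Subgroup (orthGroup B)}
    {A : Matrix (Fin m) (Fin m) ℂ} (hA : A ∈ closureMatrices u G) : Aᵀ ∈ closureMatrices u G := by
  obtain ⟨g, hg, rfl⟩ := hA
  exact ⟨g⁻¹, hu.inv_mem_zariskiClosure G hg, hu.isometryMatrix_inv g⟩

omit hu [AddCommGroup V] [Module ℂ V] in
/-- A polynomial function is a Laurent polynomial along a curve `A₀ + z A₁ + z⁻¹ A₂`. -/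
theorem exists_polynomial_of_mem_polyFun {W : Type*} [AddCommGroup W] [Module ℂ W] (a b c : W)
    {p : W → ℂ} (hp : p ∈ polyFun W) : ∃ (N : ℕ) (P : Polynomial ℂ),
      ∀ z : ℂ, z ≠ 0 → z ^ N * p (a + z • b + z⁻¹ • c) = P.eval z := by
  induction hp using Algebra.adjoin_induction with
  | mem f hf =>
    obtain ⟨φ, rfl⟩ := hf
    refine ⟨1, Polynomial.C (φ a) * Polynomial.X + Polynomial.C (φ b) * Polynomial.X ^ 2 +
      Polynomial.C (φ c), fun z hz => ?_⟩
    simp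
    field_simp
  | algebraMap r => exact ⟨0, Polynomial.C r, fun z _ => by simp⟩
  | add f g _ _ hf hg =>
    obtain ⟨N, P, hP⟩ := hf
    obtain ⟨N', P', hP'⟩ := hg
    refine ⟨N + N', Polynomial.X ^ N' * P + Polynomial.X ^ N * P', fun z hz => ?_⟩
    simp only [Polynomial.eval_add, Polynomial.eval_mul, Polynomial.eval_pow, Polynomial.eval_X,
      ← hP z hz, ← hP' z hz, Pi.add_apply]
    ring
  | mul f g _ _ hf hg =>
    obtain ⟨N, P, hP⟩ := hf
    obtain ⟨N', P', hP'⟩ := hg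
    refine ⟨N + N', P * P', fun z hz => ?_⟩
    simp only [Polynomial.eval_mul, ← hP z hz, ← hP' z hz, Pi.mul_apply]
    ring

omit hu in
-- The two constant 2 × 2 matrices are the projections onto the isotropic eigenlines of the plane
-- rotations, for the eigenvalues `z` and `z⁻¹`.
theorem block_rot_eq (i : ℕ) (z : ℂ) : (block i (rot z) : Matrix (Fin m) (Fin m) ℂ) =
    (1 - planeIncl m i * (planeIncl m i)ᵀ) +
    z • (planeIncl m i * !![1 / 2, Complex.I / 2; -(Complex.I / 2), 1 / 2] * (planeIncl m i)ᵀ) +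
    z⁻¹ • (planeIncl m i * !![1 / 2, -(Complex.I / 2); Complex.I / 2, 1 / 2] *
      (planeIncl m i)ᵀ) := by
  have : rot z = z • !![1 / 2, Complex.I / 2; -(Complex.I / 2), 1 / 2] +
      z⁻¹ • !![1 / 2, -(Complex.I / 2); Complex.I / 2, 1 / 2] := by
    ext a b
    fin_cases a <;> fin_cases b <;> simp [rot] <;> ring
  rw [block_eq, this]
  simp only [Matrix.mul_sub, Matrix.sub_mul, Matrix.mul_add, Matrix.add_mul, Matrix.mul_smul,
    Matrix.smul_mul, Matrix.mul_one]
  abel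

/-- The Zariski closure of an infinite cyclic group of plane rotations contains all rotations of
that plane. -/
theorem IsOrthonormalBasis.block_rot_mem_closureMatrices {G : Subgroup (orthGroup B)} {i : ℕ}
    (hi : i + 1 < m) {ζ : ℂ} (hζ : ζ ≠ 0) (hmem : block i (rot ζ) ∈ closureMatrices u G)
    (hinf : ¬ IsOfFinOrder (block i (rot ζ) : Matrix (Fin m) (Fin m) ℂ)) {z : ℂ} (hz : z ≠ 0) :
    block i (rot z) ∈ closureMatrices u G := by
  have horth : (block i (rot z) : Matrix (Fin m) (Fin m) ℂ)ᵀ * block i (rot z) = 1 := by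
    have hrot : (rot z)ᵀ = rot z⁻¹ := by
      ext a b
      fin_cases a <;> fin_cases b <;> simp [rot] <;> ring
    have : (block i (rot z) : Matrix (Fin m) (Fin m) ℂ)ᵀ = block i (rot z)ᵀ := by
      rw [block_eq, block_eq]
      simp [Matrix.mul_assoc]
    rw [this, hrot, block_mul_block hi, rot_mul, inv_mul_cancel₀ hz, rot_one, block_one]
  have hpow : ∀ k : ℕ, block i (rot (ζ ^ k)) ∈ closureMatrices u G := fun k => by
    rw [← rot_pow, ← block_pow hi]
    exact Submonoid.pow_mem _ hmem k
  have hinj : Function.Injective fun k : ℕ => ζ ^ k := by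
    have hζ' : ∀ k : ℕ, 0 < k → ζ ^ k ≠ 1 := fun k hk h => hinf <| by
      rw [isOfFinOrder_iff_pow_eq_one]
      exact ⟨k, hk, by rw [block_pow hi, rot_pow, h, rot_one, block_one]⟩
    intro k l hkl
    refine (injective_pow_iff_not_isOfFinOrder (x := Units.mk0 ζ hζ)).2 ?_ (Units.ext ?_)
    · rw [isOfFinOrder_iff_pow_eq_one]
      rintro ⟨k, hk, h⟩
      exact hζ' k hk (by simpa using congrArg Units.val h)
    · simpa using hkl
  obtain ⟨g, hg⟩ := hu.exists_isometryMatrix_eq horth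
  refine ⟨g, fun p hp hpX => ?_, hg⟩
  set p' : Matrix (Fin m) (Fin m) ℂ → ℂ := p ∘ (Matrix.toLin u u).toLinearMap with hp'
  have hval : ∀ h : orthGroup B, p (orthToEnd h) = p' (isometryMatrix u h) := fun h =>
    congrArg p (Matrix.toLin_toMatrix u u _).symm
  obtain ⟨N, P, hP⟩ := exists_polynomial_of_mem_polyFun
    (1 - planeIncl m i * (planeIncl m i)ᵀ)
    (planeIncl m i * !![1 / 2, Complex.I / 2; -(Complex.I / 2), 1 / 2] * (planeIncl m i)ᵀ)
    (planeIncl m i * !![1 / 2, -(Complex.I / 2); Complex.I / 2, 1 / 2] * (planeIncl m i)ᵀ)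
    (polyFun_comp_linearMap (Matrix.toLin u u).toLinearMap hp)
  simp only [← block_rot_eq] at hP
  -- The powers of `ζ` are pairwise distinct since the rotation has infinite order, and each of them
  -- is a root of `P`.
  have hP0 : P = 0 := by
    refine Polynomial.eq_zero_of_infinite_isRoot P
      ((Set.infinite_range_of_injective hinj).mono ?_)
    rintro _ ⟨k, rfl⟩
    obtain ⟨h, hh, hhk⟩ := hpow k
    have h0 : p' (block i (rot (ζ ^ k))) = 0 := by
      rw [← hhk, ← hval]
      exact hh p hp hpX
    exact (hP _ (pow_ne_zero k hζ)).symm.trans (mul_eq_zero_of_right _ h0)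
  have h0 := hP z hz
  rw [hP0, Polynomial.eval_zero] at h0
  rw [hval, hg]
  exact (mul_eq_zero.1 h0).resolve_left (pow_ne_zero N hz)

end Closure

/-! ### The orthonormal basis -/

section Basis

variable {n : ℕ} {q s : ℂ}

theorem qInt_succ (q : ℂ) (m : ℕ) : qInt q (m + 1) = qInt q m + q ^ m :=
  Finset.sum_range_succ _ _

/-- The closed form of the Gram–Schmidt vectors. -/
noncomputable def gsVec (n : ℕ) (q s : ℂ) (k : ℕ) : Fin n → ℂ := fun j =>
  if (j : ℕ) ≤ k then s ^ (k + 1) / qInt q (k + 1)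
  else if (j : ℕ) = k + 1 then -(s ^ (k + 1))⁻¹ else 0

theorem ne_zero_of_sq_eq (hq : q ≠ 0) (hs : s ^ 2 = q) : s ≠ 0 := by
  rintro rfl
  exact hq (by rw [← hs]; simp)

theorem form_ff (hq : q ≠ 0) (hs : s ^ 2 = q) (v : Fin n → ℂ) (i : Fin (n - 1)) :
    form n q v (ff hq hs i : Fin n → ℂ) = s ^ ((i : ℕ) + 1) * (v (lo i) - v (hi i)) := by
  have hs0 := ne_zero_of_sq_eq hq hs
  have : (ff hq hs i : Fin n → ℂ) = (s ^ ((i : ℕ) + 1))⁻¹ • root q i := ff_eq hq hs i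
  rw [this, map_smul, form_root, smul_eq_mul, ← hs]
  field_simp
  ring

/-- Pairing with `f_i` measures the jump between coordinates `i` and `i + 1`. The vector `gsVec n q
s k` is constant up to `k` and zero beyond `k + 1`, so it jumps only at `i = k` and `i = k + 1`. -/
theorem form_gsVec_ff_eq_zero (hq : q ≠ 0) (hs : s ^ 2 = q) {k : ℕ} {i : Fin (n - 1)}
    (h1 : (i : ℕ) ≠ k) (h2 : (i : ℕ) ≠ k + 1) :
    form n q (gsVec n q s k) (ff hq hs i : Fin n → ℂ) = 0 := by
  rw [form_ff]
  have h : gsVec n q s k (lo i) = gsVec n q s k (hi i) := by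
    have hlo : (lo i : ℕ) = i := rfl
    have hhi : (hi i : ℕ) = i + 1 := rfl
    simp only [gsVec]
    by_cases h : (i : ℕ) < k
    · rw [if_pos (by omega), if_pos (by omega)]
    · rw [if_neg (by omega), if_neg (by omega), if_neg (by omega), if_neg (by omega)]
  rw [h, sub_self, mul_zero]

theorem form_gsVec_ff_succ (hq : q ≠ 0) (hs : s ^ 2 = q) {k : ℕ} (hk : k + 1 < n - 1) :
    form n q (gsVec n q s k) (ff hq hs ⟨k + 1, hk⟩ : Fin n → ℂ) = -s := by
  have hs0 := ne_zero_of_sq_eq hq hs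
  rw [form_ff]
  simp [gsVec, lo, hi]
  field_simp
  ring

variable (hn : qFactorial q n ≠ 0)
include hn

theorem form_gsVec_ff_self (hq : q ≠ 0) (hs : s ^ 2 = q) (i : Fin (n - 1)) :
    form n q (gsVec n q s i) (ff hq hs i : Fin n → ℂ) = qInt q (i + 2) / qInt q (i + 1) := by
  have hs0 := ne_zero_of_sq_eq hq hs
  have h1 : qInt q (i + 1) ≠ 0 := qInt_ne hn (by omega)
  rw [form_ff, qInt_succ q (i + 1)]
  simp [gsVec, lo, hi]
  field_simp
  rw [← hs]
  ring

omit hn in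
theorem gsVec_zero (hq : q ≠ 0) (hs : s ^ 2 = q) (h0 : 0 < n - 1) :
    gsVec n q s 0 = (ff hq hs ⟨0, h0⟩ : Fin n → ℂ) := by
  ext j
  simp only [gsVec, ff, eN, e, lo, hi, Pi.sub_apply, Pi.smul_apply, Pi.single_apply, Fin.ext_iff]
  split_ifs <;> first | omega | simp [qInt]

/-- The Gram–Schmidt step: the coefficient is `-⟨f_{k+1}, v_k⟩ / ⟨v_k, v_k⟩`, with numerator pairing
`-s` and square norm `[k+2] / [k+1]`. -/
theorem gsVec_succ (hq : q ≠ 0) (hs : s ^ 2 = q) {k : ℕ} (hk : k + 1 < n - 1) :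
    gsVec n q s (k + 1) = (ff hq hs ⟨k + 1, hk⟩ : Fin n → ℂ) +
      (s * qInt q (k + 1) / qInt q (k + 2)) • gsVec n q s k := by
  have hs0 := ne_zero_of_sq_eq hq hs
  have h1 : qInt q (k + 1) ≠ 0 := qInt_ne hn (by omega)
  have h2 : qInt q (k + 2) ≠ 0 := qInt_ne hn (m := k + 1) (by omega)
  have h3 := qInt_succ q (k + 1)
  ext j
  simp only [gsVec, ff, eN, e, lo, hi, Pi.sub_apply, Pi.add_apply, Pi.smul_apply, Pi.single_apply,
    Fin.ext_iff, smul_eq_mul]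
  by_cases c1 : (j : ℕ) ≤ k
  · rw [if_pos (by omega), if_neg (by omega), if_neg (by omega), if_pos c1]
    field_simp
    ring
  by_cases c2 : (j : ℕ) = k + 1
  · rw [if_pos (by omega), if_pos (by omega), if_neg (by omega), if_neg c1, if_pos c2]
    field_simp
    have : q ^ (k + 1) = s ^ (2 * (k + 1)) := by rw [pow_mul, hs]
    rw [this] at h3
    linear_combination -(s ^ (k + 3)) * h3
  by_cases c3 : (j : ℕ) = k + 2
  · rw [if_neg (by omega), if_pos (by omega), if_neg (by omega), if_pos (by omega), if_neg c1,
      if_neg c2]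
    simp
  · rw [if_neg (by omega), if_neg (by omega), if_neg (by omega), if_neg (by omega), if_neg c1,
      if_neg c2]
    simp

theorem form_gsVec_gsVec_of_lt (hq : q ≠ 0) (hs : s ^ 2 = q) {k l : ℕ} (hkl : k < l)
    (hl : l < n - 1) : form n q (gsVec n q s l) (gsVec n q s k) = 0 := by
  induction k with
  | zero =>
    rw [gsVec_zero hq hs (by omega)]
    exact form_gsVec_ff_eq_zero hq hs (by simp; omega) (by simp)
  | succ k ih =>
    rw [gsVec_succ hn hq hs (by omega), map_add, map_smul, ih (by omega), smul_zero, add_zero]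
    exact form_gsVec_ff_eq_zero hq hs (by simp; omega) (by simp; omega)

theorem form_gsVec_gsVec_of_ne (hq : q ≠ 0) (hs : s ^ 2 = q) {k l : ℕ} (hkl : k ≠ l)
    (hk : k < n - 1) (hl : l < n - 1) : form n q (gsVec n q s k) (gsVec n q s l) = 0 := by
  rcases lt_or_gt_of_ne hkl with h | h
  · rw [form_comm, form_gsVec_gsVec_of_lt hn hq hs h hl]
  · exact form_gsVec_gsVec_of_lt hn hq hs h hk

theorem form_gsVec_gsVec_self (hq : q ≠ 0) (hs : s ^ 2 = q) {k : ℕ} (hk : k < n - 1) :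
    form n q (gsVec n q s k) (gsVec n q s k) = qInt q (k + 2) / qInt q (k + 1) := by
  rw [← form_gsVec_ff_self hn hq hs ⟨k, hk⟩]
  cases k with
  | zero => conv_lhs => rw [gsVec_zero hq hs hk]
            rw [← gsVec_zero hq hs hk]
  | succ k =>
    conv_lhs => arg 2; rw [gsVec_succ hn hq hs hk]
    rw [map_add, map_smul, form_gsVec_gsVec_of_lt hn hq hs (Nat.lt_succ_self k) hk, smul_zero,
      add_zero]

theorem coe_vv (hq : q ≠ 0) (hs : s ^ 2 = q) (i : Fin (n - 1)) :
    (vv hq hs i : Fin n → ℂ) = gsVec n q s i := by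
  induction i using WellFoundedLT.induction with
  | _ i ih =>
  have hform : ∀ j : Finset.Iio i, ∀ w : F n q,
      formF n q w (bilinGramSchmidt (formF n q) (ff hq hs) j) =
        form n q w (gsVec n q s (j : Fin (n - 1))) := fun j w =>
    congrArg (form n q w) (ih j (Finset.mem_Iio.1 j.2))
  rw [vv, bilinGramSchmidt, Submodule.coe_sub, Submodule.coe_sum]
  obtain ⟨i, hi⟩ := i
  cases i with
  | zero =>
    rw [gsVec_zero hq hs hi, Finset.sum_eq_zero, sub_zero]
    rintro ⟨j, hj⟩ -
    exact absurd (Fin.lt_def.1 (Finset.mem_Iio.1 hj)) (Nat.not_lt_zero _)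
  | succ k =>
    have hk : (⟨k, by omega⟩ : Fin (n - 1)) ∈ Finset.Iio (⟨k + 1, hi⟩ : Fin (n - 1)) := by
      simp
    -- Only the immediately preceding vector contributes, since `f_{k+1}` is orthogonal to all
    -- earlier ones.
    rw [Finset.sum_eq_single ⟨⟨k, by omega⟩, hk⟩, gsVec_succ hn hq hs hi, sub_eq_add_neg,
      Submodule.coe_smul, ← neg_smul]
    · congr 2
      · rw [hform, hform]
        have h := ih _ (Finset.mem_Iio.1 hk)
        rw [vv] at h
        rw [h, form_comm, form_gsVec_ff_succ hq hs hi, form_gsVec_gsVec_self hn hq hs (by omega), neg_div, neg_neg, div_div_eq_mul_div]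
      · exact ih _ (Finset.mem_Iio.1 hk)
    · intro j _ hj
      have hjk : ((j : Fin (n - 1)) : ℕ) ≠ k := fun h => hj (Subtype.ext (Fin.ext h))
      have hjk' := Fin.lt_def.1 (Finset.mem_Iio.1 j.2)
      change ((j : Fin (n - 1)) : ℕ) < k + 1 at hjk'
      rw [hform, form_comm, form_gsVec_ff_eq_zero hq hs (by simp; omega) (by simp; omega)]
      simp
    · simp

variable {r : ℕ → ℂ} (hr : ∀ k, r k ^ 2 = qInt q k)

theorem isOrthonormalBasis_uBasis (hq : q ≠ 0) (hs : s ^ 2 = q) :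
    IsOrthonormalBasis (formF n q) (uBasis hq hs hr hn) := by
  intro i j
  have hcoe : ∀ i, (uBasis hq hs hr hn i : Fin n → ℂ) =
      ((r (i + 1))⁻¹ * (r (i + 2))⁻¹ * qInt q (i + 1)) • gsVec n q s i := fun i => by
    rw [uBasis, coe_basisOfTopLeSpanOfCardEqFinrank, uu, Submodule.coe_smul, Submodule.coe_smul,
      coe_vv hn, smul_smul]
  change form n q (uBasis hq hs hr hn i : Fin n → ℂ) (uBasis hq hs hr hn j : Fin n → ℂ) = _
  rw [hcoe, hcoe, map_smul, map_smul, LinearMap.smul_apply]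
  split_ifs with hij
  · subst hij
    have h1 : qInt q (i + 1) ≠ 0 := qInt_ne hn (by omega)
    have h2 : qInt q (i + 2) ≠ 0 := qInt_ne hn (m := i + 1) (by omega)
    have h3 : r (i + 1) ≠ 0 := fun h => h1 (by rw [← hr, h]; simp)
    have h4 : r (i + 2) ≠ 0 := fun h => h2 (by rw [← hr, h]; simp)
    rw [form_gsVec_gsVec_self hn hq hs i.2]
    simp only [smul_eq_mul]
    rw [← hr, ← hr]
    field_simp
  · rw [form_gsVec_gsVec_of_ne hn hq hs (fun h => hij (Fin.ext h)) i.2 j.2, smul_zero, smul_zero]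

theorem formF_uBasis_ff_eq_zero (hq : q ≠ 0) (hs : s ^ 2 = q) {i k : Fin (n - 1)}
    (h1 : (i : ℕ) ≠ k) (h2 : (i : ℕ) ≠ k + 1) :
    formF n q (uBasis hq hs hr hn k) (ff hq hs i) = 0 := by
  have h : formF n q (vv hq hs k) (ff hq hs i) = 0 := by
    change form n q (vv hq hs k : Fin n → ℂ) (ff hq hs i : Fin n → ℂ) = 0
    rw [coe_vv hn, form_gsVec_ff_eq_zero hq hs h1 h2]
  rw [uBasis, coe_basisOfTopLeSpanOfCardEqFinrank, uu, map_smul, map_smul, LinearMap.smul_apply,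
    LinearMap.smul_apply, h, smul_zero, smul_zero]

end Basis

/-! ### The matrices of the generators -/

section Generators

variable {n : ℕ} {q₁ q₂ s : ℂ} (h₁ : q₁ ≠ 0) (h₂ : q₂ ≠ 0) (h₁₂ : q₁ ≠ q₂)
  (hs : s ^ 2 = ratio q₁ q₂) {r : ℕ → ℂ} (hr : ∀ k, r k ^ 2 = qInt (ratio q₁ q₂) k)
  (hn : qFactorial (ratio q₁ q₂) n ≠ 0)

/-- The coordinates of `f_i` in the orthonormal basis. -/
noncomputable def ffCoord (i : Fin (n - 1)) : Fin (n - 1) → ℂ :=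
  (uBasis (ratio_ne h₁ h₂) hs hr hn).repr (ff (ratio_ne h₁ h₂) hs i)

/-- This confines each generator to one plane of adjacent coordinates, and the generator of index 0
to a line. -/
theorem ffCoord_eq_zero {i k : Fin (n - 1)} (h1 : (i : ℕ) ≠ k) (h2 : (i : ℕ) ≠ k + 1) :
    ffCoord h₁ h₂ hs hr hn i k = 0 := by
  rw [ffCoord, (isOrthonormalBasis_uBasis hn hr (ratio_ne h₁ h₂) hs).repr_apply]
  exact formF_uBasis_ff_eq_zero hn hr _ hs h1 h2

theorem ffCoord_dotProduct (i : Fin (n - 1)) (v : F n (ratio q₁ q₂)) :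
    ffCoord h₁ h₂ hs hr hn i ⬝ᵥ (uBasis (ratio_ne h₁ h₂) hs hr hn).repr v =
      s ^ ((i : ℕ) + 1) * ((v : Fin n → ℂ) (lo i) - (v : Fin n → ℂ) (hi i)) := by
  have hu := isOrthonormalBasis_uBasis hn hr (ratio_ne h₁ h₂) hs
  have h : formF n (ratio q₁ q₂) v (ff (ratio_ne h₁ h₂) hs i) =
      ffCoord h₁ h₂ hs hr hn i ⬝ᵥ (uBasis (ratio_ne h₁ h₂) hs hr hn).repr v := by
    conv_lhs => rw [← (uBasis (ratio_ne h₁ h₂) hs hr hn).sum_repr v]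
    rw [map_sum, LinearMap.sum_apply]
    refine Finset.sum_congr rfl fun k _ => ?_
    rw [map_smul, LinearMap.smul_apply, ffCoord, hu.repr_apply (ff _ _ _), smul_eq_mul, mul_comm]
  rw [← h]
  exact form_ff (ratio_ne h₁ h₂) hs (v : Fin n → ℂ) i

theorem ffCoord_dotProduct_self (i : Fin (n - 1)) :
    ffCoord h₁ h₂ hs hr hn i ⬝ᵥ ffCoord h₁ h₂ hs hr hn i = 1 + ratio q₁ q₂ := by
  have hs0 := ne_zero_of_sq_eq (ratio_ne h₁ h₂) hs
  refine (ffCoord_dotProduct h₁ h₂ hs hr hn i (ff (ratio_ne h₁ h₂) hs i)).trans ?_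
  simp [ff, eN, e, lo, hi]
  rw [← hs]
  field_simp
  ring

/-- The generators act by orthogonal reflections. -/
theorem isometryMatrix_twinGen (i : Fin (n - 1)) :
    isometryMatrix (uBasis (ratio_ne h₁ h₂) hs hr hn) (reducedRep n h₁ h₁₂ (twinGen i)) =
      reflMatrix (ffCoord h₁ h₂ hs hr hn i) := by
  have hs0 := ne_zero_of_sq_eq (ratio_ne h₁ h₂) hs
  set u := uBasis (ratio_ne h₁ h₂) hs hr hn with hu
  have hrep : reducedRep n h₁ h₁₂ (twinGen i) = SF h₁ h₁₂ i := PresentedGroup.toGroup.of _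
  -- Replacing `root` by `f_i` rescales the axis by `s ^ (i + 1)`, which makes the coefficient the
  -- pairing of `v` with `f_i`.
  have hSF : ∀ v : F n (ratio q₁ q₂), orthToEnd (SF h₁ h₁₂ i) v =
      v - (2 / (1 + ratio q₁ q₂) *
        (s ^ ((i : ℕ) + 1) * ((v : Fin n → ℂ) (lo i) - (v : Fin n → ℂ) (hi i)))) •
        ff (ratio_ne h₁ h₂) hs i := by
    intro v
    refine Subtype.ext ((S_apply h₁ h₁₂ i v).trans ?_)
    have : (ff (ratio_ne h₁ h₂) hs i : Fin n → ℂ) =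
      (s ^ ((i : ℕ) + 1))⁻¹ • root (ratio q₁ q₂) i := ff_eq (ratio_ne h₁ h₂) hs i
    rw [Submodule.coe_sub, Submodule.coe_smul, this, smul_smul]
    congr 2
    field_simp
  rw [hrep]
  refine Matrix.ext_of_mulVec_single fun k => ?_
  have hk : (Pi.single k 1 : Fin (n - 1) → ℂ) = u.repr (u k) := by
    rw [u.repr_self]
    exact (Finsupp.single_eq_pi_single k 1).symm
  rw [hk]
  refine (LinearMap.toMatrix_mulVec_repr u u _ _).trans ?_
  rw [hSF, reflMatrix_mulVec, ffCoord_dotProduct_self, ffCoord_dotProduct, map_sub, map_smul]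
  rfl

end Generators

/-! ### Density in one plane, and passage to all coordinate planes -/

section Main

variable {V : Type*} [AddCommGroup V] [Module ℂ V] {B : LinearMap.BilinForm ℂ V} {m : ℕ}
  {u : Module.Basis (Fin m) ℂ V} (hu : IsOrthonormalBasis B u) {G : Subgroup (orthGroup B)}

include hu in
/-- An infinite-order product of two reflections of a coordinate plane, together with one of the
reflections, generates a Zariski dense subgroup of the orthogonal group of that plane. -/
theorem IsOrthonormalBasis.block_mem_closureMatrices {i : ℕ} (hi : i + 1 < m) {y : Fin 2 → ℂ}
    (hy : y ⬝ᵥ y ≠ 0) (hD : D (⟨i, by omega⟩ : Fin m) ∈ closureMatrices u G)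
    (hR : block i (reflMatrix y) ∈ closureMatrices u G)
    (hinf : ¬ IsOfFinOrder (D (⟨i, by omega⟩ : Fin m) * block i (reflMatrix y)))
    {A : Matrix (Fin 2) (Fin 2) ℂ} (hA : Aᵀ * A = 1) : block i A ∈ closureMatrices u G := by
  have h10 : (![1, 0] : Fin 2 → ℂ) ⬝ᵥ ![1, 0] ≠ 0 := by simp
  have hmem := Submonoid.mul_mem _ hD hR
  rw [← block_reflMatrix_left hi] at hD hinf hmem
  rw [block_mul_block hi] at hinf hmem
  obtain ⟨ζ, hζ, hrot⟩ := exists_eq_rot (A := reflMatrix ![1, 0] * reflMatrix y) (by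
      rw [transpose_mul, Matrix.mul_assoc, ← Matrix.mul_assoc (reflMatrix ![1, 0])ᵀ,
        transpose_mul_reflMatrix, Matrix.one_mul, transpose_mul_reflMatrix]) (by
      rw [det_mul, det_reflMatrix h10, det_reflMatrix hy]; norm_num)
  rw [hrot] at hinf hmem
  have hSO : ∀ z ≠ 0, block i (rot z) ∈ closureMatrices u G := fun z hz =>
    hu.block_rot_mem_closureMatrices hi hζ hmem hinf hz
  rcases det_eq_one_or hA with hdet | hdet
  · obtain ⟨z, hz, rfl⟩ := exists_eq_rot hA hdet
    exact hSO z hz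
  -- Multiplication by the reflection `D_i` of the plane reduces determinant -1 to the case of a
  -- rotation.
  · obtain ⟨z, hz, hzA⟩ := exists_eq_rot (A := reflMatrix ![1, 0] * A) (by
        rw [transpose_mul, Matrix.mul_assoc, ← Matrix.mul_assoc (reflMatrix ![1, 0])ᵀ,
          transpose_mul_reflMatrix, Matrix.one_mul, hA]) (by
        rw [det_mul, det_reflMatrix h10, hdet]; norm_num)
    have : A = reflMatrix ![1, 0] * rot z := by
      rw [← hzA, ← Matrix.mul_assoc, reflMatrix_mul_self, Matrix.one_mul]
    rw [this, ← block_mul_block hi]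
    exact Submonoid.mul_mem _ hD (hSO z hz)

/-- A submonoid of matrices containing the orthogonal groups of all planes of consecutive
coordinates and the diagonal reflections contains the reflections in all coordinate planes. -/
theorem reflectsPlane_of_block_mem {M : Submonoid (Matrix (Fin m) (Fin m) ℂ)}
    (hblock : ∀ i : ℕ, i + 1 < m → ∀ A : Matrix (Fin 2) (Fin 2) ℂ, Aᵀ * A = 1 → block i A ∈ M)
    (hD : ∀ k : Fin m, D k ∈ M) (i j : Fin m) :
    ReflectsPlane (M : Set (Matrix (Fin m) (Fin m) ℂ)) i j := by
  have hadj : ∀ (i : ℕ) (hi : i + 1 < m),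
      ReflectsPlane (M : Set (Matrix (Fin m) (Fin m) ℂ)) ⟨i, by omega⟩ ⟨i + 1, hi⟩ := by
    intro i hi x hx _
    rw [eq_planeIncl_mulVec hi (x := x)
      fun k h1 h2 => hx k (fun h => h1 (Fin.ext_iff.1 h)) (fun h => h2 (Fin.ext_iff.1 h)),
      reflMatrix_planeIncl_mulVec hi]
    exact hblock i hi _ (transpose_mul_reflMatrix _)
  have hlt : ∀ (d i : ℕ) (h : i + d + 1 < m),
      ReflectsPlane (M : Set (Matrix (Fin m) (Fin m) ℂ)) ⟨i, by omega⟩ ⟨i + d + 1, h⟩ := by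
    intro d
    induction d with
    | zero => exact fun i h => hadj i h
    | succ d ih =>
      intro i h
      exact ReflectsPlane.trans (by simp [Fin.ext_iff]; omega) (by simp [Fin.ext_iff])
        (ih i (by omega)) (hadj (i + d + 1) h)
  have hlt' : ∀ i j : Fin m, i < j → ReflectsPlane (M : Set (Matrix (Fin m) (Fin m) ℂ)) i j := by
    intro i j hij
    obtain ⟨d, hd⟩ := Nat.exists_eq_add_of_lt (Fin.lt_def.1 hij)
    have hj : j = ⟨i + d + 1, hd ▸ j.2⟩ := Fin.ext hd
    rw [hj]
    exact hlt d i _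
  rcases lt_trichotomy i j with h | rfl | h
  · exact hlt' i j h
  -- For `i = j` the plane degenerates to a line and the reflection is `D i`. The separate
  -- hypothesis `hD` covers this even when `m = 1` and there are no blocks.
  · intro x hx hx0
    have hxi : x = x i • Pi.single i 1 := by
      ext k
      by_cases hk : k = i
      · subst hk; simp
      · simp [hk, hx k hk hk]
    have hi0 : x i ≠ 0 := by
      rintro h0
      rw [h0, zero_smul] at hxi
      exact hx0 (by rw [hxi]; simp)
    rw [hxi, reflMatrix_smul hi0, reflMatrix_single]
    exact hD i
  · exact (hlt' j i h).symm

end Main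
end TwinRep

open Matrix

theorem mainTheorem6 (n : ℕ) (q₁ q₂ : ℂ) (h₁ : q₁ ≠ 0) (h₂ : q₂ ≠ 0) (h₁₂ : q₁ ≠ q₂)
    (s : ℂ) (hs : s ^ 2 = ratio q₁ q₂)
    (r : ℕ → ℂ) (hr : ∀ k, r k ^ 2 = qInt (ratio q₁ q₂) k)
    (hn : qFactorial (ratio q₁ q₂) n ≠ 0)
    (hinf : ∀ (i : ℕ) (hi : i + 1 < n - 1),
      ¬ IsOfFinOrder (D (⟨i, by omega⟩ : Fin (n - 1)) *
        orthMatrix (uBasis (ratio_ne h₁ h₂) hs hr hn)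
          (reducedRep n h₁ h₁₂ (twinGen ⟨i + 1, hi⟩)))) :
    (∀ i : ℕ, i + 1 < n - 1 → ∀ A : Matrix (Fin 2) (Fin 2) ℂ, A.transpose * A = 1 →
      ∃ g ∈ zariskiClosure (formF n (ratio q₁ q₂)) (Set.range (reducedRep n h₁ h₁₂)),
        orthMatrix (uBasis (ratio_ne h₁ h₂) hs hr hn) g = block i A) ∧
    (∀ k : Fin (n - 1),
      ∃ g ∈ zariskiClosure (formF n (ratio q₁ q₂)) (Set.range (reducedRep n h₁ h₁₂)),
        orthMatrix (uBasis (ratio_ne h₁ h₂) hs hr hn) g = D k) ∧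
    zariskiClosure (formF n (ratio q₁ q₂)) (Set.range (reducedRep n h₁ h₁₂)) = Set.univ := by
  have hu := isOrthonormalBasis_uBasis hn hr (ratio_ne h₁ h₂) hs
  set u := uBasis (ratio_ne h₁ h₂) hs hr hn with hu_def
  set G : Subgroup (orthGroup (formF n (ratio q₁ q₂))) := (reducedRep n h₁ h₁₂).range with hG
  have hgen : ∀ i, reflMatrix (ffCoord h₁ h₂ hs hr hn i) ∈ closureMatrices u G := fun i =>
    ⟨_, subset_zariskiClosure _ ⟨twinGen i, rfl⟩, isometryMatrix_twinGen h₁ h₂ h₁₂ hs hr hn i⟩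
  have hself : ∀ i, ffCoord h₁ h₂ hs hr hn i ⬝ᵥ ffCoord h₁ h₂ hs hr hn i ≠ 0 := fun i => by
    rw [ffCoord_dotProduct_self]
    exact one_add_ratio_ne h₁ h₁₂
  have hblock_of : ∀ (i : ℕ) (hi : i + 1 < n - 1),
      D (⟨i, by omega⟩ : Fin (n - 1)) ∈ closureMatrices u G →
      ∀ A : Matrix (Fin 2) (Fin 2) ℂ, A.transpose * A = 1 → block i A ∈ closureMatrices u G := by
    intro i hi hD A hA
    -- The generator of index `i + 1` reflects inside the plane of coordinates `i` and `i + 1`, the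
    -- same plane that contains the axis of `D_i`.
    have hx := eq_planeIncl_mulVec hi (x := ffCoord h₁ h₂ hs hr hn ⟨i + 1, hi⟩) fun k hk1 hk2 =>
      ffCoord_eq_zero h₁ h₂ hs hr hn (Ne.symm hk2) (by simpa using Ne.symm hk1)
    have hR := hgen ⟨i + 1, hi⟩
    have hself' := hself ⟨i + 1, hi⟩
    have hinf' : ¬ IsOfFinOrder (D (⟨i, by omega⟩ : Fin (n - 1)) *
        reflMatrix (ffCoord h₁ h₂ hs hr hn ⟨i + 1, hi⟩)) := by
      rw [← isometryMatrix_twinGen h₁ h₂ h₁₂]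
      exact hinf i hi
    rw [hx, reflMatrix_planeIncl_mulVec hi] at hR hinf'
    rw [hx, dotProduct_mulVec, vecMul_mulVec, planeIncl_transpose_mul hi, vecMul_one] at hself'
    exact hu.block_mem_closureMatrices hi hself' hD hR hinf' hA
  -- The bootstrap: `D_0` is the first generator, and `D_k` yields the orthogonal group of the plane
  -- of `k` and `k + 1`, which contains `D_{k+1}`.
  have hD : ∀ (k : ℕ) (hk : k < n - 1), D (⟨k, hk⟩ : Fin (n - 1)) ∈ closureMatrices u G := by
    intro k
    induction k with
    | zero =>
      intro hk
      have hsingle : ffCoord h₁ h₂ hs hr hn ⟨0, hk⟩ =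
          ffCoord h₁ h₂ hs hr hn ⟨0, hk⟩ ⟨0, hk⟩ • Pi.single ⟨0, hk⟩ 1 := by
        ext k
        by_cases h : k = ⟨0, hk⟩
        · subst h; simp
        · have h' : (k : ℕ) ≠ 0 := fun h' => h (Fin.ext h')
          rw [ffCoord_eq_zero h₁ h₂ hs hr hn (Ne.symm h') (Nat.succ_ne_zero _).symm]
          simp [h]
      have hne : ffCoord h₁ h₂ hs hr hn ⟨0, hk⟩ ⟨0, hk⟩ ≠ 0 := by
        intro h
        rw [h, zero_smul] at hsingle
        exact hself ⟨0, hk⟩ (by rw [hsingle]; simp)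
      have h := hgen ⟨0, hk⟩
      rwa [hsingle, reflMatrix_smul hne, reflMatrix_single] at h
    | succ k ih =>
      intro hk
      rw [← block_reflMatrix_right hk]
      exact hblock_of k hk (ih (by omega)) _ (transpose_mul_reflMatrix _)
  have hblock : ∀ i : ℕ, i + 1 < n - 1 → ∀ A : Matrix (Fin 2) (Fin 2) ℂ, A.transpose * A = 1 →
      block i A ∈ closureMatrices u G := fun i hi => hblock_of i hi (hD i _)
  refine ⟨hblock, fun k => hD k k.2, Set.eq_univ_of_forall fun g => ?_⟩
  obtain ⟨g', hg', hgg'⟩ := mem_of_transpose_mul_self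
    (reflectsPlane_of_block_mem hblock fun k => hD k k.2)
    (fun A hA => hu.transpose_mem_closureMatrices hA) (hu.transpose_mul_isometryMatrix g)
  exact isometryMatrix_injective u hgg' ▸ hg'
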